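/- Let $S$ be a monoid. A (left) $S$-act is a set $A$ with an action of $S$ such that $1a=a$ and $s(ta)=(st)a$; embeddings are injective $S$-homomorphisms, and $A\le B$ means that $A$ is a subact of $B$. A left ideal of $S$ is a subact of $S$. Let $\gamma(S)$ be the least infinite cardinal such that every left ideal of $S$ is generated by fewer than $\gamma(S)$ elements, and let $\gamma_r(S)=\gamma(S)$ if $\gamma(S)$ is regular and $\gamma_r(S)=\gamma(S)^+$ if $\gamma(S)$ is singular. For an act $M$, consider pairs $(b,N)$ with $M\le N$ and $b\in N$. Two pairs $(b_1,N_1)$, $(b_2,N_2)$ are atomically equivalent if there are an act $P$ and embeddings $f_\ell:N_\ell\to P$ ($\ell=1,2$), both fixing $M$ pointwise, with $f_1(b_1)=f_2(b_2)$; the classes of the transitive closure of this relation are the Galois types over $M$. The class $(S\text{-acts},\le)$ is stable in a cardinal $\lambda\ge \operatorname{card}(S)+\aleph_0$ if over every act of cardinality $\lambda$ there are at most $\lambda$ Galois types. An act $B$ is universal over $A$ if $A\le B$, $A$ and $B$ have the same cardinality $\mu$, and for every act $N$ of cardinality $\mu$ with $A\le N$ there is an embedding $N\to B$ fixing $A$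 pointwise. For an infinite cardinal $\lambda$, an act $M$ is a $\lambda$-limit model if there are a limit ordinal $\alpha<\lambda^+$ and an increasing chain $(M_i)_{i<\alpha}$ of acts of cardinality $\lambda$ with $M=\bigcup_{i<\alpha}M_i$, such that $M_i=\bigcup_{j<i}M_j$ for every limit ordinal $i<\alpha$ and $M_{i+1}$ is universal over $M_i$ for every $i<\alpha$. Theorem. Let $n\ge 1$ be an integer. The following are equivalent. 1. $\gamma_r(S)=\aleph_n$. 2. For every cardinal $\lambda\ge 2^{\operatorname{card}(S)+\aleph_0}$ such that $(S\text{-acts},\le)$ is stable in $\lambda$, there are, up to isomorphism, exactly $n+1$ $\lambda$-limit models. -/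

import Mathlib

open Cardinal

universe u

namespace SActs

/-! ### The cardinals `γ(S)` and `γ_r(S)` -/

/-- Every left ideal of `S` (a subact of `S` acting on itself by left multiplication) is generated
by fewer than `κ` elements. -/
def IdealsGeneratedByLT (S : Type u) [Monoid S] (κ : Cardinal.{u}) : Prop :=
  ∀ I : SubMulAction S S, ∃ X : Set S, #X < κ ∧ SubMulAction.closure S X = I

/-- `γ(S)`: the least infinite cardinal `κ` such that every left ideal of `S` is generated by fewer
than `κ` elements. The set is never empty, see `gamma_spec`. -/
noncomputable def gamma (S : Type u) [Monoid S] : Cardinal.{u} :=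
  sInf {κ : Cardinal.{u} | ℵ₀ ≤ κ ∧ IdealsGeneratedByLT S κ}

/-- The infimum defining `γ(S)` is a minimum. -/
theorem gamma_spec (S : Type u) [Monoid S] : ℵ₀ ≤ gamma S ∧ IdealsGeneratedByLT S (gamma S) := by
  have hne : {κ : Cardinal.{u} | ℵ₀ ≤ κ ∧ IdealsGeneratedByLT S κ}.Nonempty := by
    refine ⟨Order.succ (#S + ℵ₀), ?_, fun I => ⟨(I : Set S), ?_, ?_⟩⟩
    · exact le_trans (self_le_add_left _ _) (Order.le_succ _)
    · rw [Order.lt_succ_iff]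
      exact (mk_set_le _).trans (self_le_add_right _ _)
    · exact le_antisymm (SubMulAction.closure_le.2 le_rfl) SubMulAction.subset_closure
  exact csInf_mem hne

open Classical in
/-- `γ_r(S)`: equal to `γ(S)` if `γ(S)` is regular and to `γ(S)⁺` if `γ(S)` is singular. -/
noncomputable def gammaR (S : Type u) [Monoid S] : Cardinal.{u} :=
  if (gamma S).IsRegular then gamma S else Order.succ (gamma S)

/-! ### Galois types and stability for `S`-acts with embeddings -/

/-- A triple `(b, M, N)` where `N` is an `S`-act extending `M` (through the embedding `incl`) and
`b` is an element of `N`. -/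
structure PreType (S : Type u) [Monoid S] (M : Type u) [MulAction S M] : Type (u + 1) where
  /-- the underlying set of the extension `N` of `M` -/
  carrier : Type u
  /-- the action of `S` on `N` -/
  [act : MulAction S carrier]
  /-- the embedding of `M` in `N` -/
  incl : M →[S] carrier
  /-- `incl` is an embedding -/
  incl_injective : Function.Injective incl
  /-- the element whose type over `M` is considered -/
  elt : carrier

attribute [instance] PreType.act

/-- Atomic equivalence of triples: both extensions of `M` embed over `M` in a common act, with the
two elements identified. -/
def PreType.AtomicEquiv {S : Type u} [Monoid S] {M : Type u} [MulAction S M]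
    (p q : PreType S M) : Prop :=
  ∃ (P : Type u) (_ : MulAction S P) (f : p.carrier →[S] P) (g : q.carrier →[S] P),
    Function.Injective f ∧ Function.Injective g ∧
      (∀ m : M, f (p.incl m) = g (q.incl m)) ∧ f p.elt = g q.elt

/-- The transitive closure of `PreType.AtomicEquiv` is an equivalence relation. -/
def preTypeSetoid (S : Type u) [Monoid S] (M : Type u) [MulAction S M] : Setoid (PreType S M) where
  r := Relation.TransGen PreType.AtomicEquiv
  iseqv :=
    { refl := fun p => Relation.TransGen.single
        ⟨p.carrier, p.act, MulActionHom.id S, MulActionHom.id S,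
          fun _ _ h => h, fun _ _ h => h, fun _ => rfl, rfl⟩
      symm := fun {p q} h => by
        have hs : ∀ {a b : PreType S M}, a.AtomicEquiv b → b.AtomicEquiv a := by
          rintro a b ⟨P, hP, f, g, hf, hg, hM, he⟩
          exact ⟨P, hP, g, f, hg, hf, fun m => (hM m).symm, he.symm⟩
        induction h with
        | single h => exact Relation.TransGen.single (hs h)
        | tail _ h ih => exact Relation.TransGen.head (hs h) ih
      trans := fun h₁ h₂ => Relation.TransGen.trans h₁ h₂ }

/-- The set of Galois types of single elements over the act `M`. -/
def GaloisType (S : Type u) [Monoid S] (M : Type u) [MulAction S M] : Type (u + 1) :=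
  Quotient (preTypeSetoid S M)

/-- The class of `S`-acts with embeddings is stable in `lam`: there are at most `lam` Galois types
over each act of cardinality `lam`. -/
def IsStableIn (S : Type u) [Monoid S] (lam : Cardinal.{u}) : Prop :=
  #S + ℵ₀ ≤ lam ∧
    ∀ (M : Type u) [MulAction S M], #M = lam →
      #(GaloisType S M) ≤ Cardinal.lift.{u + 1} lam

/-! ### Universal extensions and limit models -/

/-- For subacts `A`, `B` of an act: `B` is universal over `A`, i.e. `A ≤ B`, `A` and `B` have the
same cardinality, and every extension of `A` of that cardinality embeds in `B` over `A`. -/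
def IsUniversalOver {S : Type u} [Monoid S] {M : Type u} [MulAction S M]
    (B A : SubMulAction S M) : Prop :=
  A ≤ B ∧ #B = #A ∧
    ∀ (N : Type u) [MulAction S N] (j : A →[S] N), Function.Injective j → #N = #A →
      ∃ f : N →[S] B, Function.Injective f ∧ ∀ a : A, (f (j a) : M) = (a : M)

/-- `M` is a `(lam, α)`-limit model over its subact `N`: it is the union of an increasing continuous
chain `(c i)`, `i < α`, of subacts of cardinality `lam`, which starts at `N` and in which each
`c (i + 1)` is universal over `c i`. Here `lam` is an infinite cardinal and `α < lam⁺` is a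
limit ordinal. Values `c i` with `α ≤ i` play no role. -/
def IsLimitModelOver {S : Type u} [Monoid S] (lam : Cardinal.{u}) (α : Ordinal.{u})
    (M : Type u) [MulAction S M] (N : SubMulAction S M) : Prop :=
  ℵ₀ ≤ lam ∧ Order.IsSuccLimit α ∧ α < (Order.succ lam).ord ∧
    ∃ c : Ordinal.{u} → SubMulAction S M,
      (∀ i < α, #(c i) = lam) ∧
      (∀ i j, i ≤ j → j < α → c i ≤ c j) ∧
      (∀ i < α, Order.IsSuccLimit i → (c i : Set M) = ⋃ j < i, (c j : Set M)) ∧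
      c 0 = N ∧
      (⋃ i < α, (c i : Set M)) = Set.univ ∧
      ∀ i < α, IsUniversalOver (c (Order.succ i)) (c i)

/-- `M` is a `lam`-limit model: a `(lam, α)`-limit model over some `N`, for some limit ordinal
`α < lam⁺`. -/
def IsLimitModel (S : Type u) [Monoid S] (lam : Cardinal.{u}) (M : Type u) [MulAction S M] :
    Prop :=
  ∃ (α : Ordinal.{u}) (N : SubMulAction S M), IsLimitModelOver lam α M N

/-- Isomorphism of `S`-acts: a bijective `S`-homomorphism. -/
def IsIsomorphic (S : Type u) [Monoid S] (A B : Type u) [MulAction S A] [MulAction S B] : Prop :=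
  ∃ f : A →[S] B, Function.Bijective f

/-- There are exactly `k` `lam`-limit models up to isomorphism: some list of `k` pairwise
non-isomorphic `lam`-limit models contains an isomorphic copy of every `lam`-limit model. -/
def HasExactlyLimitModels (S : Type u) [Monoid S] (lam : Cardinal.{u}) (k : ℕ) : Prop :=
  ∃ (L : Fin k → Type u) (_ : ∀ i, MulAction S (L i)),
    (∀ i, IsLimitModel S lam (L i)) ∧
    (∀ i j, i ≠ j → ¬ IsIsomorphic S (L i) (L j)) ∧
    ∀ (M : Type u) [MulAction S M], IsLimitModel S lam M → ∃ i, IsIsomorphic S M (L i)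

end SActs

/-!
The proof counts limit models by the cofinality of their lengths. Write `δ` for the cofinality of
the length of a `lam`-limit model, a regular cardinal `≤ lam`, and `γ = γ(S)`.

* Limit models with the same `δ` are isomorphic (`IsUniversalChain.isIsomorphic_of_cof_eq`), by a
  back-and-forth of length `δ` between partial isomorphisms whose domain and range lie in a proper
  initial segment of the chains.
* Limit models with `δ ≥ γ` are all isomorphic. An element `n` of an act `N` attaches to the domain
  of a partial isomorphism through the ideal of those `s` with `s n` in the domain. This ideal has
  fewer than `γ` generators, so its image lies in one step of the chain, and the next step contains
  `lam` copies of `n` which are disjoint over this step. Hence the model realizes every such type,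
  freely over any fewer than `lam` elements (`IsUniversalChain.isFull`), and a back-and-forth of
  length `lam` applies (`IsFull.isIsomorphic`).
* A limit model with `δ < γ` is not isomorphic to one with `δ' > δ`
  (`IsUniversalChain.not_isIsomorphic`). Some ideal is not generated by fewer than `δ` elements; by
  recursion one gets an ideal with `δ` generators and a homomorphism from it to the first model
  whose values leave every step of the chain, so that it does not extend to `S`. In the second
  model every homomorphism from an ideal with `δ` generators is bounded, and so it extends to `S`.

So if `γ = ℵ_m`, the classes are given by `δ = ℵ_0, …, ℵ_(m-1)` and `δ ≥ ℵ_m`, while `γ ≥ ℵ_(n+1)`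
gives at least `n + 2` classes. Moreover `γ_r(S) = ℵ_n` is equivalent to `γ(S) = ℵ_n`, since every
infinite cardinal below `ℵ_n` is regular.

Amalgamation is replaced by the cofree acts `S → X`: a homomorphism from a subact of `N` to `S → X`
is a function to `X`, and it extends to `N` by sending the new elements of `N` to new elements of
`X` (`exists_cofree_extension`). With `X` of cardinality greater than `lam`, such an act is a
monster model in which all constructions take place. Limit models exist in every stable `lam`
(`IsStableIn.exists_isLimitModelOver`), because a chain of length `lam` in which each step realizes
all types over the previous one ends in a universal extension. Finally, `2 ^ (#S + ℵ₀)` is a stable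
cardinal (`isStableIn_two_power`), as the type of `b` over `M` is determined by the relation
`s b = t b` and the partial function `s ↦ s b` to `M`.
-/

namespace SActs

open Order

/-! ### Transfinite recursion and cofinalities -/

/-- Construction of an increasing continuous chain by transfinite recursion: `P i` is the property
kept at stage `i`, and `R i` relates stage `i` to the next one. -/
theorem exists_transfinite_chain {L : Type*} [CompleteLattice L] (κ : Ordinal.{u}) (G₀ : L)
    (P : Ordinal.{u} → L → Prop) (R : Ordinal.{u} → L → L → Prop) (h0 : P 0 G₀)
    (hs : ∀ i < κ, ∀ G, P i G → ∃ G', G ≤ G' ∧ P (succ i) G' ∧ R i G G')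
    (hl : ∀ i ≤ κ, IsSuccLimit i → ∀ c : Ordinal.{u} → L, Monotone c →
      (∀ j < i, P j (c j)) → P i (⨆ j < i, c j)) :
    ∃ c : Ordinal.{u} → L, Monotone c ∧ c 0 = G₀ ∧
      (∀ i, IsSuccLimit i → c i = ⨆ j < i, c j) ∧
      (∀ i ≤ κ, P i (c i)) ∧ ∀ i < κ, R i (c i) (c (succ i)) := by
  classical
  let F : Ordinal.{u} → L → L := fun i G =>
    if h : ∃ G', G ≤ G' ∧ P (succ i) G' ∧ R i G G' then h.choose else G
  have hF : ∀ i G, G ≤ F i G := by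
    intro i G
    by_cases h : ∃ G', G ≤ G' ∧ P (succ i) G' ∧ R i G G'
    · simp only [F, dif_pos h]; exact h.choose_spec.1
    · simp only [F, dif_neg h]; exact le_rfl
  let c : Ordinal.{u} → L := WellFoundedLT.fix (fun i ih => G₀ ⊔ ⨆ j : {j // j < i}, F j (ih j j.2))
  have hc : ∀ i, c i = G₀ ⊔ ⨆ j : {j // j < i}, F j (c j) := fun i => WellFoundedLT.fix_eq _ i
  have hlt : ∀ {i j}, j < i → F j (c j) ≤ c i := by
    intro i j h
    rw [hc i]
    exact le_sup_of_le_right (le_iSup (fun j : {j // j < i} => F j (c j)) ⟨j, h⟩)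
  have hmono : Monotone c := by
    intro i j hij
    rcases hij.eq_or_lt with rfl | h
    · exact le_rfl
    · exact (hF _ _).trans (hlt h)
  have hsucc : ∀ i, c (succ i) = F i (c i) := by
    intro i
    refine le_antisymm ?_ (hlt (lt_succ i))
    rw [hc (succ i)]
    refine sup_le ?_ (iSup_le ?_)
    · exact le_trans (by rw [hc i]; exact le_sup_left) (hF i _)
    · rintro ⟨j, hj⟩
      rcases (lt_succ_iff.1 hj).eq_or_lt with rfl | h
      · exact le_rfl
      · exact (hlt h).trans (hF _ _)
  have hzero : c 0 = G₀ := by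
    rw [hc 0]
    refine le_antisymm (sup_le le_rfl (iSup_le ?_)) le_sup_left
    rintro ⟨j, hj⟩
    exact absurd hj not_lt_zero
  have hlim : ∀ i, IsSuccLimit i → c i = ⨆ j < i, c j := by
    intro i hi
    refine le_antisymm ?_ (iSup₂_le fun j hj => hmono hj.le)
    rw [hc i]
    refine sup_le ?_ (iSup_le ?_)
    · rw [← hzero]
      exact le_iSup₂_of_le 0 hi.bot_lt le_rfl
    · rintro ⟨j, hj⟩
      exact le_iSup₂_of_le (succ j) (hi.succ_lt hj) (hsucc j).ge
  have hP : ∀ i ≤ κ, P i (c i) := by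
    intro i
    induction i using Ordinal.limitRecOn with
    | zero =>
      intro _
      rwa [hzero]
    | add_one a ih =>
      intro hle
      have ha := succ_le_iff.1 hle
      have h := hs a ha _ (ih ha.le)
      rw [← Order.succ_eq_add_one, hsucc]
      simp only [F, dif_pos h]; exact h.choose_spec.2.1
    | limit a ha ih =>
      intro hle
      rw [hlim a ha]
      exact hl a hle ha c hmono fun j hj => ih j hj (hj.le.trans hle)
  refine ⟨c, hmono, hzero, hlim, hP, fun i hi => ?_⟩
  have h := hs i hi _ (hP i hi.le)
  rw [hsucc]
  simp only [F, dif_pos h]; exact h.choose_spec.2.2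

theorem mk_biUnion_lt_le {X : Type u} {i : Ordinal.{u}} {κ : Cardinal.{u}}
    {G : Ordinal.{u} → Set X} (h : ∀ j < i, #(G j) ≤ κ) :
    #(⋃ j < i, G j : Set X) ≤ i.card * κ := by
  have he : (⋃ j < i, G j : Set X) = ⋃ k : i.ToType, G k.toOrd := by
    ext x
    simp only [Set.mem_iUnion]
    constructor
    · rintro ⟨j, hj, hx⟩
      exact ⟨Ordinal.ToType.mk ⟨j, hj⟩, by simpa using hx⟩
    · rintro ⟨k, hx⟩
      exact ⟨_, k.toOrd.2, hx⟩
  rw [he]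
  refine (mk_iUnion_le _).trans ?_
  rw [mk_toType]
  gcongr
  exact ciSup_le' fun k => h _ k.toOrd.2

theorem exists_bound_of_lt_cof {α : Ordinal.{u}} {ι : Type u} (hι : #ι < α.cof)
    {f : ι → Ordinal.{u}} (hf : ∀ k, f k < α) : ∃ a < α, ∀ k, f k ≤ a :=
  ⟨_, Ordinal.iSup_lt_of_lt_cof hι hf, fun k => Ordinal.le_iSup f k⟩

theorem exists_bound_Iio_of_lt_cof {α i : Ordinal.{u}} (hi : i < α.cof.ord)
    {f : Ordinal.{u} → Ordinal.{u}} (hf : ∀ k < i, f k < α) : ∃ a < α, ∀ k < i, f k ≤ a := by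
  obtain ⟨a, ha, h⟩ := exists_bound_of_lt_cof (ι := i.ToType) (α := α)
    (by rw [mk_toType]; exact lt_ord.1 hi) (f := fun k => f k.toOrd) (fun k => hf _ k.toOrd.2)
  refine ⟨a, ha, fun k hk => ?_⟩
  simpa using h (Ordinal.ToType.mk ⟨k, hk⟩)

/-- The values `β i` with `α.cof.ord ≤ i` play no role. -/
theorem exists_cofinal_map (α : Ordinal.{u}) (hα : α ≠ 0) :
    ∃ β : Ordinal.{u} → Ordinal.{u}, (∀ i, β i < α) ∧ ∀ a < α, ∃ i < α.cof.ord, a ≤ β i := by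
  classical
  obtain ⟨f, hf⟩ := Ordinal.exists_isFundamentalSeq (o := α) rfl
  refine ⟨fun i => if h : i < α.cof.ord then f ⟨i, h⟩ else 0, fun i => ?_, fun a ha => ?_⟩
  · by_cases h : i < α.cof.ord
    · simp only [dif_pos h]; exact (f ⟨i, h⟩).2
    · simp only [dif_neg h]; exact pos_iff_ne_zero.2 hα
  · obtain ⟨_, ⟨⟨i, hi⟩, rfl⟩, h⟩ := hf.isCofinal_range ⟨a, ha⟩
    exact ⟨i, hi, by simp only [dif_pos (show i < α.cof.ord from hi)]; exact h⟩

/-- The values `m i` with `κ.ord ≤ i` play no role. -/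
theorem exists_enumeration {X : Type u} {κ : Cardinal.{u}} (hX : #X = κ) (h0 : κ ≠ 0) :
    ∃ m : Ordinal.{u} → X, ∀ x, ∃ i < κ.ord, m i = x := by
  classical
  have hne : Nonempty X := by rwa [← mk_ne_zero_iff, hX]
  have : #κ.ord.ToType = #X := by rw [mk_ord_toType, hX]
  obtain ⟨e⟩ := Cardinal.eq.1 this
  refine ⟨fun i => if h : i < κ.ord then e (Ordinal.ToType.mk ⟨i, h⟩) else Classical.arbitrary X,
    fun x => ⟨(e.symm x).toOrd, (e.symm x).toOrd.2, ?_⟩⟩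
  have h := (e.symm x).toOrd.2
  rw [Set.mem_Iio] at h
  simp only [dif_pos h]
  exact (congrArg e (Ordinal.ToType.mk.apply_symm_apply _)).trans (e.apply_symm_apply x)

/-! ### Partial homomorphisms and cofree acts -/

section
variable {S : Type u} [Monoid S]

/-- The cofree act on a set `X`: functions `S → X`, on which `S` acts by
`(s • f) t = f (t * s)`. Homomorphisms from an act `N` to it correspond to functions `N → X`. -/
def Cofree (S X : Type u) : Type u := S → X

instance (X : Type u) : MulAction S (Cofree S X) where
  smul s f := fun t => f (t * s)
  one_smul f := funext fun t => congrArg f (mul_one t)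
  mul_smul s s' f := funext fun t => congrArg f (mul_assoc t s s').symm

/-- The homomorphism to a cofree act which corresponds to a function. -/
def Cofree.lift {X N : Type u} [MulAction S N] (φ : N → X) : N →[S] Cofree S X where
  toFun x := fun t => φ (t • x)
  map_smul' s x := funext fun t => congrArg φ (mul_smul t s x).symm

theorem Cofree.lift_apply {X N : Type u} [MulAction S N] (φ : N → X) (x : N) (t : S) :
    Cofree.lift (S := S) φ x t = φ (t • x) := rfl

variable {N M : Type u} [MulAction S N] [MulAction S M]

/-- A subact of `N × M` is seen as a partial multivalued homomorphism from `N` to `M`; this is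
its domain. -/
def dom (G : SubMulAction S (N × M)) : SubMulAction S N where
  carrier := {x | ∃ y, (x, y) ∈ G}
  smul_mem' s _ := fun ⟨y, h⟩ => ⟨s • y, G.smul_mem s h⟩

/-- The range of a partial multivalued homomorphism. -/
def ran (G : SubMulAction S (N × M)) : SubMulAction S M where
  carrier := {y | ∃ x, (x, y) ∈ G}
  smul_mem' s _ := fun ⟨x, h⟩ => ⟨s • x, G.smul_mem s h⟩

/-- `G` is the graph of a homomorphism defined on `dom G`. -/
def IsPartialHom (G : SubMulAction S (N × M)) : Prop :=
  ∀ ⦃x y y'⦄, (x, y) ∈ G → (x, y') ∈ G → y = y'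

/-- `G` is the graph of an isomorphism from `dom G` to `ran G`. -/
structure IsPartialIso (G : SubMulAction S (N × M)) : Prop where
  hom : IsPartialHom G
  inj : ∀ ⦃x x' y⦄, (x, y) ∈ G → (x', y) ∈ G → x = x'

/-- The inverse of a partial multivalued homomorphism. -/
def inverse (G : SubMulAction S (N × M)) : SubMulAction S (M × N) where
  carrier := {p | (p.2, p.1) ∈ G}
  smul_mem' s _ h := G.smul_mem s h

theorem IsPartialIso.inverse {G : SubMulAction S (N × M)} (h : IsPartialIso G) :
    IsPartialIso (inverse G) :=
  ⟨fun _ _ _ h₁ h₂ => h.inj h₁ h₂, fun _ _ _ h₁ h₂ => h.hom h₁ h₂⟩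

theorem IsPartialHom.exists_hom {G : SubMulAction S (N × M)} (hG : IsPartialHom G)
    (h : ∀ x, x ∈ dom G) : ∃ f : N →[S] M, ∀ x, (x, f x) ∈ G := by
  choose f hf using h
  exact ⟨⟨f, fun s x => hG (hf (s • x)) (G.smul_mem s (hf x))⟩, hf⟩

theorem IsPartialIso.isIsomorphic {G : SubMulAction S (N × M)} (hG : IsPartialIso G)
    (h : ∀ x, x ∈ dom G) (h' : ∀ y, y ∈ ran G) : IsIsomorphic S N M := by
  obtain ⟨f, hf⟩ := hG.hom.exists_hom h
  refine ⟨f, fun x x' hx => hG.inj (hf x) (hx ▸ hf x'), fun y => ?_⟩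
  obtain ⟨x, hx⟩ := h' y
  exact ⟨x, hG.hom (hf x) hx⟩

/-- The subact generated by one element. -/
def orb (x : N) : SubMulAction S N where
  carrier := {y | ∃ s : S, s • x = y}
  smul_mem' t _ := fun ⟨s, h⟩ => ⟨t * s, by rw [mul_smul, h]⟩

theorem self_mem_orb (x : N) : x ∈ orb (S := S) x := ⟨1, one_smul _ _⟩

theorem mk_orb_le (x : N) : #(orb (S := S) x) ≤ #S :=
  mk_le_of_surjective (f := fun s : S => (⟨s • x, s, rfl⟩ : orb (S := S) x))
    fun ⟨_, s, h⟩ => ⟨s, Subtype.ext h⟩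

theorem mem_biSup {i : Ordinal.{u}} {c : Ordinal.{u} → SubMulAction S N} {x : N} :
    x ∈ (⨆ j < i, c j) ↔ ∃ j < i, x ∈ c j := by
  simp [SubMulAction.mem_iSup]

theorem coe_biSup {i : Ordinal.{u}} {c : Ordinal.{u} → SubMulAction S N} :
    ((⨆ j < i, c j : SubMulAction S N) : Set N) = ⋃ j < i, (c j : Set N) := by
  ext x
  simp

theorem mk_sup_le {G H : SubMulAction S N} : #(G ⊔ H : SubMulAction S N) ≤ #G + #H :=
  mk_union_le (G : Set N) (H : Set N)

theorem mk_biSup_le {i : Ordinal.{u}} {c : Ordinal.{u} → SubMulAction S N} {κ : Cardinal.{u}}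
    (h : ∀ j < i, #(c j) ≤ κ) : #(⨆ j < i, c j : SubMulAction S N) ≤ i.card * κ := by
  have := mk_biUnion_lt_le (G := fun j => (c j : Set N)) h
  rwa [← coe_biSup] at this

theorem mk_mono {G H : SubMulAction S N} (h : G ≤ H) : #G ≤ #H :=
  mk_le_mk_of_subset (s := (G : Set N)) (t := (H : Set N)) h

theorem mk_ran_le (G : SubMulAction S (N × M)) : #(ran G) ≤ #G :=
  mk_le_of_surjective (f := fun p : G => (⟨p.1.2, p.1.1, p.2⟩ : ran G))
    fun ⟨y, x, h⟩ => ⟨⟨(x, y), h⟩, rfl⟩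

theorem mk_inverse_le (G : SubMulAction S (N × M)) : #(inverse G) ≤ #G :=
  mk_le_of_surjective (f := fun p : G => (⟨(p.1.2, p.1.1), p.2⟩ : inverse G))
    fun ⟨(_, _), h⟩ => ⟨⟨_, h⟩, rfl⟩

theorem IsPartialHom.biSup {i : Ordinal.{u}} {c : Ordinal.{u} → SubMulAction S (N × M)}
    (hc : Monotone c) (h : ∀ j < i, IsPartialHom (c j)) : IsPartialHom (⨆ j < i, c j) := by
  intro x y y' h₁ h₂
  obtain ⟨j, hj, h₁⟩ := mem_biSup.1 h₁
  obtain ⟨k, hk, h₂⟩ := mem_biSup.1 h₂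
  exact h _ (max_lt hj hk) (hc (le_max_left j k) h₁) (hc (le_max_right j k) h₂)

theorem IsPartialIso.biSup {i : Ordinal.{u}} {c : Ordinal.{u} → SubMulAction S (N × M)}
    (hc : Monotone c) (h : ∀ j < i, IsPartialIso (c j)) : IsPartialIso (⨆ j < i, c j) := by
  refine ⟨IsPartialHom.biSup hc fun j hj => (h j hj).hom, ?_⟩
  intro x x' y h₁ h₂
  obtain ⟨j, hj, h₁⟩ := mem_biSup.1 h₁
  obtain ⟨k, hk, h₂⟩ := mem_biSup.1 h₂
  exact (h _ (max_lt hj hk)).inj (hc (le_max_left j k) h₁) (hc (le_max_right j k) h₂)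

/-- The element `b` realizes the image under the partial isomorphism `G` of the quantifier free type
of `n` over `dom G`. -/
def MatchesOver (G : SubMulAction S (N × M)) (n : N) (b : M) : Prop :=
  (∀ s t : S, s • n = t • n ↔ s • b = t • b) ∧
    ∀ (s : S) ⦃x y⦄, (x, y) ∈ G → (s • n = x ↔ s • b = y)

theorem MatchesOver.inverse {G : SubMulAction S (N × M)} {n : N} {b : M} (h : MatchesOver G n b) :
    MatchesOver (inverse G) b n :=
  ⟨fun s t => (h.1 s t).symm, fun s _ _ hxy => (h.2 s hxy).symm⟩

/-- The one-point extension of a partial isomorphism. -/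
theorem IsPartialIso.sup_orb {G : SubMulAction S (N × M)} (hG : IsPartialIso G) {n : N} {b : M}
    (h : MatchesOver G n b) : IsPartialIso (G ⊔ orb (n, b)) := by
  constructor
  · rintro x y y' (h₁ | ⟨s, h₁⟩) (h₂ | ⟨t, h₂⟩)
    · exact hG.hom h₁ h₂
    · obtain ⟨rfl, rfl⟩ := Prod.mk.inj h₂
      exact ((h.2 t h₁).1 rfl).symm
    · obtain ⟨rfl, rfl⟩ := Prod.mk.inj h₁
      exact ((h.2 s h₂).1 rfl)
    · obtain ⟨rfl, rfl⟩ := Prod.mk.inj h₁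
      obtain ⟨h₃, rfl⟩ := Prod.mk.inj h₂
      exact (h.1 _ _).1 h₃.symm
  · rintro x x' y (h₁ | ⟨s, h₁⟩) (h₂ | ⟨t, h₂⟩)
    · exact hG.inj h₁ h₂
    · obtain ⟨rfl, rfl⟩ := Prod.mk.inj h₂
      exact ((h.2 t h₁).2 rfl).symm
    · obtain ⟨rfl, rfl⟩ := Prod.mk.inj h₁
      exact ((h.2 s h₂).2 rfl)
    · obtain ⟨rfl, rfl⟩ := Prod.mk.inj h₁
      obtain ⟨rfl, h₃⟩ := Prod.mk.inj h₂
      exact (h.1 _ _).2 h₃.symm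

/-- An extension of a partial isomorphism which is as free as possible is injective. -/
theorem IsPartialIso.injective_of_extension {G : SubMulAction S (N × M)} (hG : IsPartialIso G)
    {D : Set M} (hr : (ran G : Set M) ⊆ D) {h : N → M} (hext : ∀ ⦃x y⦄, (x, y) ∈ G → h x = y)
    (hinj : ∀ ⦃x x'⦄, x ∉ dom G → x' ∉ dom G → h x = h x' → x = x')
    (hD : ∀ x ∉ dom G, h x ∉ D) : Function.Injective h := by
  have hGD : ∀ {x}, x ∈ dom G → h x ∈ D := by
    rintro x ⟨y, hxy⟩
    rw [hext hxy]
    exact hr ⟨_, hxy⟩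
  intro x x' hxx
  by_cases hx : x ∈ dom G <;> by_cases hx' : x' ∈ dom G
  · obtain ⟨y, hy⟩ := hx
    obtain ⟨y', hy'⟩ := hx'
    rw [hext hy, hext hy'] at hxx
    subst hxx
    exact hG.inj hy hy'
  · exact absurd (hxx ▸ hGD hx) (hD _ hx')
  · exact absurd (hxx ▸ hGD hx') (hD _ hx)
  · exact hinj hx hx' hxx

/-- Partial homomorphisms to a large cofree act extend, with new elements sent injectively outside
of a given small set. -/
theorem exists_cofree_extension {X : Type u} {G : SubMulAction S (N × Cofree S X)}
    (hG : IsPartialHom G) (D : Set (Cofree S X)) (hX : ℵ₀ ≤ #X) (hN : #N < #X) (hD : #D < #X) :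
    ∃ g : N →[S] Cofree S X, (∀ ⦃x y⦄, (x, y) ∈ G → g x = y) ∧
      (∀ ⦃x x'⦄, x ∉ dom G → x' ∉ dom G → g x = g x' → x = x') ∧ ∀ x ∉ dom G, g x ∉ D := by
  classical
  -- New elements are told apart by their values at `1`, which avoid the values of `D` at `1`.
  let V : Set X := (fun d : Cofree S X => d 1) '' D
  have hV : #V < #X := mk_image_le.trans_lt hD
  have : Infinite X := infinite_iff.2 hX
  have hVc : #(Vᶜ : Set X) = #X := mk_compl_of_infinite V hV
  obtain ⟨e⟩ : Nonempty (N ↪ (Vᶜ : Set X)) := by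
    rw [← Cardinal.le_def, hVc]; exact hN.le
  let φ : N → X := fun x => if h : x ∈ dom G then h.choose 1 else e x
  have hφ : ∀ ⦃x⦄, x ∉ dom G → φ x = e x := fun x hx => dif_neg hx
  have hg1 : ∀ x, Cofree.lift (S := S) φ x 1 = φ x := fun x => congrArg φ (one_smul S x)
  refine ⟨Cofree.lift φ, ?_, ?_, ?_⟩
  · intro x y hxy
    funext t
    -- The value of `y` at `t` is the value of `t • y` at `1`.
    have hd : t • x ∈ dom G := ⟨_, G.smul_mem t hxy⟩
    rw [Cofree.lift_apply]
    simp only [φ, dif_pos hd]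
    rw [hG hd.choose_spec (G.smul_mem t hxy)]
    exact congrArg y (one_mul t)
  · intro x x' hx hx' h
    have h1 := congrFun h 1
    rw [hg1, hg1, hφ hx, hφ hx'] at h1
    exact e.injective (Subtype.ext h1)
  · intro x hx hD
    apply (e x).2
    exact ⟨_, hD, by rw [← hφ hx, ← hg1]⟩

end

/-! ### Universal extensions -/

section
variable {S : Type u} [Monoid S] {N M : Type u} [MulAction S N] [MulAction S M]

theorem exists_cofree_embedding {X : Type u} (hX : ℵ₀ ≤ #X) (hN : #N < #X) :
    ∃ g : N →[S] Cofree S X, Function.Injective g := by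
  have hbot : ∀ x, x ∉ dom (⊥ : SubMulAction S (N × Cofree S X)) := fun x ⟨_, h⟩ => h
  obtain ⟨g, -, hg, -⟩ := exists_cofree_extension (G := (⊥ : SubMulAction S (N × Cofree S X)))
    (fun _ _ _ h => h.elim) ∅ hX hN (by rw [mk_eq_zero]; exact aleph0_pos.trans_le hX)
  exact ⟨g, fun x x' h => hg (hbot x) (hbot x') h⟩

/-- If `B` is universal over `A`, then a partial homomorphism from a small act `N` to `A` extends
to `N → B`, in a way that is as free as possible over `A`. -/
theorem IsUniversalOver.exists_extension {A B : SubMulAction S M} (hU : IsUniversalOver B A)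
    (hA : ℵ₀ ≤ #A) (hN : #N ≤ #A) {G : SubMulAction S (N × M)} (hG : IsPartialHom G)
    (hr : ran G ≤ A) :
    ∃ h : N →[S] M, (∀ x, h x ∈ B) ∧ (∀ ⦃x y⦄, (x, y) ∈ G → h x = y) ∧
      (∀ ⦃x x'⦄, x ∉ dom G → x' ∉ dom G → h x = h x' → x = x') ∧ ∀ x ∉ dom G, h x ∉ A := by
  let X : Type u := (succ #A).ord.ToType
  have hXA : #X = succ #A := mk_ord_toType _
  have hAX : #A < #X := hXA ▸ lt_succ _
  have hX : ℵ₀ ≤ #X := hA.trans hAX.le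
  obtain ⟨e, he⟩ := exists_cofree_embedding (S := S) (N := A) hX hAX
  let Ge : SubMulAction S (N × Cofree S X) :=
    { carrier := {p | ∃ y : A, (p.1, (y : M)) ∈ G ∧ e y = p.2}
      smul_mem' := fun s p ⟨y, h, h'⟩ => ⟨s • y, G.smul_mem s h, by rw [map_smul, h']; rfl⟩ }
  have hGe : IsPartialHom Ge := by
    rintro x u u' ⟨y, h, rfl⟩ ⟨y', h', rfl⟩
    exact congrArg e (Subtype.ext (hG h h'))
  have hdom : ∀ ⦃x⦄, x ∉ dom G → x ∉ dom Ge := fun x hx ⟨u, y, h, _⟩ => hx ⟨y, h⟩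
  obtain ⟨g, hg, hginj, hgD⟩ := exists_cofree_extension hGe (Set.range e) hX (hN.trans_lt hAX)
    (mk_range_le.trans_lt hAX)
  -- A copy of the amalgam of `A` and `N` along `G`.
  let Q : SubMulAction S (Cofree S X) :=
    { carrier := Set.range e ∪ Set.range g
      smul_mem' := by
        rintro s _ (⟨a, rfl⟩ | ⟨x, rfl⟩)
        · exact Or.inl ⟨s • a, map_smul e s a⟩
        · exact Or.inr ⟨s • x, map_smul g s x⟩ }
  let j : A →[S] Q := ⟨fun a => ⟨e a, Or.inl ⟨a, rfl⟩⟩, fun s a => Subtype.ext (map_smul e s a)⟩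
  have hj : Function.Injective j := fun a a' h => he (congrArg Subtype.val h)
  have hQ : #Q = #A := by
    refine le_antisymm ?_ (mk_le_of_injective hj)
    refine (mk_union_le (Set.range e) (Set.range g)).trans ?_
    exact (add_le_add mk_range_le (mk_range_le.trans hN)).trans (add_eq_self hA).le
  obtain ⟨f, hf, hfj⟩ := hU.2.2 Q j hj hQ
  let gQ : N → Q := fun x => ⟨g x, Or.inr ⟨x, rfl⟩⟩
  have hgQ : ∀ (s : S) x, gQ (s • x) = s • gQ x := fun s x => Subtype.ext (map_smul g s x)
  refine ⟨⟨fun x => (f (gQ x) : M), fun s x => ?_⟩, fun x => (f (gQ x)).2, ?_, ?_, ?_⟩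
  · rw [hgQ, map_smul]; rfl
  · intro x y hxy
    let a : A := ⟨y, hr ⟨x, hxy⟩⟩
    have : gQ x = j a := Subtype.ext (hg ⟨a, hxy, rfl⟩)
    change (f (gQ x) : M) = y
    rw [this, hfj]
  · intro x x' hx hx' h
    exact hginj (hdom hx) (hdom hx') (congrArg Subtype.val (hf (Subtype.ext h)))
  · intro x hx hA'
    let a : A := ⟨_, hA'⟩
    have : gQ x = j a := hf (Subtype.ext (hfj a).symm)
    exact hgD x (hdom hx) ⟨a, (congrArg Subtype.val this).symm⟩

end

/-! ### Limit models of the same cofinality -/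

section
variable {S : Type u} [Monoid S] {N M M' : Type u} [MulAction S N] [MulAction S M] [MulAction S M']

/-- The act `M` is the union of the increasing chain `(c i)`, `i < α`, of subacts of cardinality
`lam`, in which each `c (i + 1)` is universal over `c i`. Compared with `IsLimitModelOver`, the
continuity of the chain is dropped. -/
structure IsUniversalChain (lam : Cardinal.{u}) (α : Ordinal.{u})
    (c : Ordinal.{u} → SubMulAction S M) : Prop where
  aleph0_le : ℵ₀ ≤ lam
  isSuccLimit : IsSuccLimit α
  lt_ord : α < (succ lam).ord
  mk_eq : ∀ i < α, #(c i) = lam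
  mono : ∀ i j, i ≤ j → j < α → c i ≤ c j
  exhausts : ∀ x, ∃ i < α, x ∈ c i
  isUniversalOver : ∀ i < α, IsUniversalOver (c (succ i)) (c i)

theorem IsLimitModelOver.exists_isUniversalChain {lam : Cardinal.{u}} {α : Ordinal.{u}}
    {N : SubMulAction S M} (h : IsLimitModelOver lam α M N) :
    ∃ c : Ordinal.{u} → SubMulAction S M, IsUniversalChain lam α c := by
  obtain ⟨h0, hα, hαl, c, hc, hm, -, -, hu, hU⟩ := h
  refine ⟨c, h0, hα, hαl, hc, hm, fun x => ?_, hU⟩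
  have : x ∈ ⋃ i < α, (c i : Set M) := hu ▸ Set.mem_univ x
  simpa using this

namespace IsUniversalChain

variable {lam : Cardinal.{u}} {α α' : Ordinal.{u}} {c : Ordinal.{u} → SubMulAction S M}
  {c' : Ordinal.{u} → SubMulAction S M'}

theorem pos (h : IsUniversalChain lam α c) : 0 < α := h.isSuccLimit.bot_lt

theorem mk_act (h : IsUniversalChain lam α c) : #M = lam := by
  refine le_antisymm ?_ ?_
  · have hu : (Set.univ : Set M) = ⋃ i < α, (c i : Set M) := by
      ext x
      simpa using h.exhausts x
    have := mk_biUnion_lt_le (i := α) (G := fun j => (c j : Set M)) fun j hj => (h.mk_eq j hj).le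
    rw [← hu, mk_univ] at this
    refine this.trans ?_
    have hα : α.card ≤ lam := by
      rw [← lt_succ_iff]; exact Cardinal.lt_ord.1 h.lt_ord
    exact (mul_le_mul_left hα _).trans (mul_eq_self h.aleph0_le).le
  · rw [← h.mk_eq 0 h.pos]
    exact mk_set_le (c 0 : Set M)

/-- The forth step: a partial isomorphism between bounded subacts extends to any subact of the
chain. -/
theorem forth (hc : IsUniversalChain lam α c) (hc' : IsUniversalChain lam α' c')
    {G : SubMulAction S (M × M')} (hG : IsPartialIso G) {j : Ordinal.{u}} (hj : j < α)
    (hd : dom G ≤ c j) (hr : ∃ k < α', ran G ≤ c' k) :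
    ∃ G' : SubMulAction S (M × M'), G ≤ G' ∧ IsPartialIso G' ∧ dom G' = c j ∧
      ∃ k < α', ran G' ≤ c' k := by
  obtain ⟨k, hk, hr⟩ := hr
  -- `G` as a partial isomorphism from the act `c j`, whose cardinality is `lam`.
  let G₁ : SubMulAction S (c j × M') :=
    { carrier := {p | ((p.1 : M), p.2) ∈ G}
      smul_mem' := fun s _ h => G.smul_mem s h }
  have hG₁ : IsPartialIso G₁ :=
    ⟨fun _ _ _ h h' => hG.hom h h', fun _ _ _ h h' => Subtype.ext (hG.inj h h')⟩
  have hr₁ : ran G₁ ≤ c' k := fun y ⟨x, h⟩ => hr ⟨x, h⟩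
  obtain ⟨h, hB, hext, hinj, hA⟩ := (hc'.isUniversalOver k hk).exists_extension
    (by rw [hc'.mk_eq k hk]; exact hc.aleph0_le) (by rw [hc'.mk_eq k hk, hc.mk_eq j hj])
    hG₁.hom hr₁
  have hhinj : Function.Injective h := hG₁.injective_of_extension hr₁ hext hinj hA
  let G' : SubMulAction S (M × M') :=
    { carrier := {p | ∃ x : c j, (x : M) = p.1 ∧ h x = p.2}
      smul_mem' := fun s p ⟨x, hx, hx'⟩ =>
        ⟨s • x, congrArg (s • ·) hx, by rw [map_smul, hx']; rfl⟩ }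
  refine ⟨G', ?_, ⟨?_, ?_⟩, ?_, succ k, hc'.isSuccLimit.succ_lt hk, ?_⟩
  · rintro ⟨x, y⟩ hxy
    exact ⟨⟨x, hd ⟨y, hxy⟩⟩, rfl, hext hxy⟩
  · rintro x y y' ⟨a, ha, rfl⟩ ⟨a', ha', rfl⟩
    exact congrArg h (Subtype.ext (ha.trans ha'.symm))
  · rintro x x' y ⟨a, rfl, ha⟩ ⟨a', rfl, ha'⟩
    exact congrArg Subtype.val (hhinj (ha.trans ha'.symm))
  · refine le_antisymm ?_ fun x hx => ⟨h ⟨x, hx⟩, ⟨x, hx⟩, rfl, rfl⟩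
    rintro x ⟨y, a, rfl, -⟩
    exact a.2
  · rintro y ⟨x, a, -, rfl⟩
    exact hB a

/-- Limit models of the same cofinality are isomorphic. -/
theorem isIsomorphic_of_cof_eq (hc : IsUniversalChain lam α c) (hc' : IsUniversalChain lam α' c')
    (hcof : α.cof = α'.cof) : IsIsomorphic S M M' := by
  obtain ⟨β, hβ, hβcof⟩ := exists_cofinal_map α hc.pos.ne'
  obtain ⟨β', hβ', hβcof'⟩ := exists_cofinal_map α' hc'.pos.ne'
  have hδ : IsSuccLimit α.cof.ord := isSuccLimit_ord (isRegular_cof hc.isSuccLimit).1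
  -- Boundedness fails at the last stage `i = α.cof.ord`, where only the union is needed.
  let P : Ordinal.{u} → SubMulAction S (M × M') → Prop := fun i G =>
    IsPartialIso G ∧ (i < α.cof.ord → (∃ j < α, dom G ≤ c j) ∧ ∃ j < α', ran G ≤ c' j)
  let R : Ordinal.{u} → SubMulAction S (M × M') → SubMulAction S (M × M') → Prop :=
    fun i _ G' => c (β i) ≤ dom G' ∧ c' (β' i) ≤ ran G'
  have h0 : P 0 ⊥ := ⟨⟨fun _ _ _ h => h.elim, fun _ _ _ h => h.elim⟩,
    fun _ => ⟨⟨0, hc.pos, fun _ ⟨_, h⟩ => h.elim⟩, ⟨0, hc'.pos, fun _ ⟨_, h⟩ => h.elim⟩⟩⟩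
  have hs : ∀ i < α.cof.ord, ∀ G, P i G → ∃ G', G ≤ G' ∧ P (succ i) G' ∧ R i G G' := by
    rintro i hi G ⟨hG, hb⟩
    obtain ⟨⟨j, hj, hd⟩, k, hk, hr⟩ := hb hi
    obtain ⟨G₁, hGG₁, hG₁, hd₁, k₁, hk₁, hr₁⟩ := hc.forth hc' hG (max_lt hj (hβ i))
      (hd.trans (hc.mono _ _ (le_max_left _ _) (max_lt hj (hβ i)))) ⟨k, hk, hr⟩
    have hm := max_lt hk₁ (hβ' i)
    obtain ⟨G₂, hGG₂, hG₂, hd₂, j₂, hj₂, hr₂⟩ := hc'.forth hc hG₁.inverse hm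
      (hr₁.trans (hc'.mono _ _ (le_max_left _ _) hm)) ⟨_, max_lt hj (hβ i), hd₁.le⟩
    refine ⟨inverse G₂, fun p hp => hGG₂ (hGG₁ hp), ⟨hG₂.inverse, fun _ => ⟨⟨j₂, hj₂, hr₂⟩,
      ⟨_, hm, hd₂.le⟩⟩⟩, ?_, ?_⟩
    · refine (hc.mono _ _ (le_max_right j _) (max_lt hj (hβ i))).trans ?_
      rw [← hd₁]
      exact fun x ⟨y, h⟩ => ⟨y, hGG₂ h⟩
    · exact (hc'.mono _ _ (le_max_right k₁ _) hm).trans hd₂.ge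
  have hl : ∀ i ≤ α.cof.ord, IsSuccLimit i → ∀ G : Ordinal.{u} → SubMulAction S (M × M'),
      Monotone G → (∀ j < i, P j (G j)) → P i (⨆ j < i, G j) := by
    intro i _ _ G hGm hP
    refine ⟨IsPartialIso.biSup hGm fun j hj => (hP j hj).1, fun hi => ⟨?_, ?_⟩⟩
    · choose! f hf hf' using fun j (hj : j < i) => ((hP j hj).2 (hj.trans hi)).1
      obtain ⟨a, ha, hfa⟩ := exists_bound_Iio_of_lt_cof hi hf
      refine ⟨a, ha, ?_⟩
      rintro x ⟨y, hxy⟩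
      obtain ⟨j, hj, hxy⟩ := mem_biSup.1 hxy
      exact hc.mono _ _ (hfa j hj) ha (hf' j hj ⟨y, hxy⟩)
    · choose! f hf hf' using fun j (hj : j < i) => ((hP j hj).2 (hj.trans hi)).2
      obtain ⟨a, ha, hfa⟩ := exists_bound_Iio_of_lt_cof (hcof ▸ hi) hf
      refine ⟨a, ha, ?_⟩
      rintro y ⟨x, hxy⟩
      obtain ⟨j, hj, hxy⟩ := mem_biSup.1 hxy
      exact hc'.mono _ _ (hfa j hj) ha (hf' j hj ⟨x, hxy⟩)
  obtain ⟨G, hGm, -, -, hP, hR⟩ := exists_transfinite_chain α.cof.ord ⊥ P R h0 hs hl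
  refine (hP _ le_rfl).1.isIsomorphic (fun x => ?_) fun y => ?_
  · obtain ⟨a, ha, hx⟩ := hc.exhausts x
    obtain ⟨i, hi, hai⟩ := hβcof a ha
    obtain ⟨y, hy⟩ := (hR i hi).1 (hc.mono _ _ hai (hβ i) hx)
    exact ⟨y, hGm (hδ.succ_lt hi).le hy⟩
  · obtain ⟨a, ha, hy⟩ := hc'.exhausts y
    obtain ⟨i, hi, hai⟩ := hβcof' a ha
    obtain ⟨x, hx⟩ := (hR i (hcof ▸ hi)).2 (hc'.mono _ _ hai (hβ' i) hy)
    exact ⟨x, hGm (hδ.succ_lt (hcof ▸ hi)).le hx⟩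

end IsUniversalChain
end

/-! ### Limit models of large cofinality -/

section
variable {S : Type u} [Monoid S] {M M' : Type u} [MulAction S M] [MulAction S M']

/-- A saturation property: every type of an element `n` of an act `N` over the domain of a small
partial isomorphism from `N` to `M` is realized in `M`. -/
def IsFull (S : Type u) [Monoid S] (lam : Cardinal.{u}) (M : Type u) [MulAction S M] : Prop :=
  ∀ (N : Type u) [MulAction S N] (G : SubMulAction S (N × M)), #N ≤ lam → IsPartialIso G →
    #G < lam → ∀ n, ∃ b : M, MatchesOver G n b

/-- Acts of cardinality `lam` which are full are isomorphic. -/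
theorem IsFull.isIsomorphic {lam : Cardinal.{u}} (hlam : #S + ℵ₀ < lam) (hM : IsFull S lam M)
    (hM' : IsFull S lam M') (hMl : #M = lam) (hMl' : #M' = lam) : IsIsomorphic S M M' := by
  have h0 : lam ≠ 0 := (pos_of_gt hlam).ne'
  have hω : ℵ₀ ≤ lam := (self_le_add_left _ _).trans hlam.le
  obtain ⟨m, hm⟩ := exists_enumeration hMl h0
  obtain ⟨m', hm'⟩ := exists_enumeration hMl' h0
  have hδ : IsSuccLimit lam.ord := isSuccLimit_ord hω
  let μ : Cardinal.{u} := #S + ℵ₀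
  have hμ : ℵ₀ ≤ μ := self_le_add_left _ _
  have hSμ : #S ≤ μ := self_le_add_right _ _
  let P : Ordinal.{u} → SubMulAction S (M × M') → Prop := fun i G =>
    IsPartialIso G ∧ #G ≤ i.card + μ
  let R : Ordinal.{u} → SubMulAction S (M × M') → SubMulAction S (M × M') → Prop :=
    fun i _ G' => m i ∈ dom G' ∧ m' i ∈ ran G'
  have hP0 : P 0 ⊥ := by
    refine ⟨⟨fun _ _ _ h => h.elim, fun _ _ _ h => h.elim⟩, ?_⟩
    have : #(⊥ : SubMulAction S (M × M')) = 0 := mk_eq_zero_iff.2 ⟨fun x => x.2.elim⟩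
    rw [this]
    exact zero_le
  have hs : ∀ i < lam.ord, ∀ G, P i G → ∃ G', G ≤ G' ∧ P (succ i) G' ∧ R i G G' := by
    rintro i hi G ⟨hG, hcard⟩
    have hi' : i.card + μ < lam := add_lt_of_lt hω (lt_ord.1 hi) hlam
    have habs : ∀ {K H : Cardinal.{u}}, K ≤ i.card + μ → H ≤ #S → K + H ≤ i.card + μ := by
      intro K H hK hH
      calc K + H ≤ i.card + μ + μ := add_le_add hK (hH.trans hSμ)
        _ = i.card + μ := by rw [add_assoc, add_eq_self hμ]
    obtain ⟨b, hb⟩ := hM' M G hMl.le hG (hcard.trans_lt hi') (m i)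
    have hG₁ := hG.sup_orb hb
    have hcard₁ : #(G ⊔ orb (m i, b) : SubMulAction S (M × M')) ≤ i.card + μ :=
      mk_sup_le.trans (habs hcard (mk_orb_le _))
    obtain ⟨a, ha⟩ := hM M' (inverse (G ⊔ orb (m i, b))) hMl'.le hG₁.inverse
      ((mk_inverse_le _).trans_lt (hcard₁.trans_lt hi')) (m' i)
    refine ⟨(G ⊔ orb (m i, b)) ⊔ orb (a, m' i), le_sup_left.trans le_sup_left,
      ⟨hG₁.sup_orb ha.inverse, ?_⟩, ⟨b, Or.inl (Or.inr (self_mem_orb _))⟩,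
      ⟨a, Or.inr (self_mem_orb _)⟩⟩
    refine (mk_sup_le.trans (habs hcard₁ (mk_orb_le _))).trans ?_
    gcongr
    exact le_succ i
  have hl : ∀ i ≤ lam.ord, IsSuccLimit i → ∀ G : Ordinal.{u} → SubMulAction S (M × M'),
      Monotone G → (∀ j < i, P j (G j)) → P i (⨆ j < i, G j) := by
    intro i _ _ G hGm hP
    refine ⟨IsPartialIso.biSup hGm fun j hj => (hP j hj).1, ?_⟩
    refine (mk_biSup_le (κ := i.card + μ) fun j hj => (hP j hj).2.trans ?_).trans ?_
    · gcongr
    · calc i.card * (i.card + μ) ≤ (i.card + μ) * (i.card + μ) := by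
            gcongr; exact self_le_add_right _ _
        _ = i.card + μ := mul_eq_self (hμ.trans (self_le_add_left _ _))
  obtain ⟨G, hGm, -, -, hP, hR⟩ := exists_transfinite_chain lam.ord ⊥ P R hP0 hs hl
  refine (hP _ le_rfl).1.isIsomorphic (fun x => ?_) fun y => ?_
  · obtain ⟨i, hi, rfl⟩ := hm x
    obtain ⟨y, hy⟩ := (hR i hi).1
    exact ⟨y, hGm (hδ.succ_lt hi).le hy⟩
  · obtain ⟨i, hi, rfl⟩ := hm' y
    obtain ⟨x, hx⟩ := (hR i hi).2
    exact ⟨x, hGm (hδ.succ_lt hi).le hx⟩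

/-- Limit models of cofinality at least `γ(S)` are full: the part of a partial isomorphism that is
relevant for one element lies in one step of the chain. -/
theorem IsUniversalChain.isFull {lam : Cardinal.{u}} {α : Ordinal.{u}}
    {c : Ordinal.{u} → SubMulAction S M} (hc : IsUniversalChain lam α c)
    (hα : gamma S ≤ α.cof) : IsFull S lam M := by
  intro N _ G hN hG hGl n
  -- `G` is bounded on `S n`, since the ideal `I` has fewer than `γ(S)` generators.
  let I : SubMulAction S S :=
    { carrier := {s | s • n ∈ dom G}
      smul_mem' := fun t s h => by
        change (t * s) • n ∈ dom G
        rw [mul_smul]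
        exact (dom G).smul_mem t h }
  obtain ⟨X, hX, hXI⟩ := (gamma_spec S).2 I
  have hval : ∀ x : X, ∃ y, ((x : S) • n, y) ∈ G := fun x =>
    (hXI ▸ SubMulAction.subset_closure x.2 : (x : S) ∈ I)
  choose v hv using hval
  choose f hf hvf using fun x => hc.exhausts (v x)
  obtain ⟨i, hi, hfi⟩ := exists_bound_of_lt_cof (hX.trans_le hα) hf
  have hbdd : ∀ s : S, ∀ y, (s • n, y) ∈ G → y ∈ c i := by
    let J : SubMulAction S S :=
      { carrier := {s | ∀ y, (s • n, y) ∈ G → y ∈ c i} ∩ I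
        smul_mem' := by
          rintro t s ⟨h, z, hz⟩
          refine ⟨fun y hy => ?_, I.smul_mem t ⟨z, hz⟩⟩
          have h2 : ((t • s) • n, t • z) ∈ G := by
            rw [smul_eq_mul, mul_smul]; exact G.smul_mem t hz
          rw [hG.hom hy h2]
          exact (c i).smul_mem t (h z hz) }
    have hIJ : I ≤ J := by
      rw [← hXI, SubMulAction.closure_le]
      intro x hx
      refine ⟨fun y hy => ?_, ⟨v ⟨x, hx⟩, hv ⟨x, hx⟩⟩⟩
      rw [hG.hom hy (hv ⟨x, hx⟩)]
      exact hc.mono _ _ (hfi ⟨x, hx⟩) hi (hvf ⟨x, hx⟩)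
    exact fun s y hy => (hIJ ⟨y, hy⟩).1 y hy
  -- Freely add `lam` copies of `n` over the bounded part of `G`.
  have hci := hc.mk_eq i hi
  let G' : SubMulAction S ((Σ _ : M, N) × M) :=
    { carrier := {p | (p.1.2, p.2) ∈ G ∧ p.2 ∈ c i}
      smul_mem' := fun s _ h => ⟨G.smul_mem s h.1, (c i).smul_mem s h.2⟩ }
  obtain ⟨h, -, hext, hinj, hA⟩ := (hc.isUniversalOver i hi).exists_extension
    (by rw [hci]; exact hc.aleph0_le) (N := Σ _ : M, N) (G := G')
    (by
      rw [hci, mk_sigma, sum_const', hc.mk_act]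
      exact (mul_le_mul_right hN _).trans (mul_eq_self hc.aleph0_le).le)
    (fun x y y' h₁ h₂ => hG.hom h₁.1 h₂.1) (fun y ⟨x, h⟩ => h.2)
  have hdom : ∀ {k : M} {s : S}, (⟨k, s • n⟩ : Σ _ : M, N) ∈ dom G' ↔ s • n ∈ dom G :=
    ⟨fun ⟨y, hy⟩ => ⟨y, hy.1⟩, fun ⟨y, hy⟩ => ⟨y, hy, hbdd _ _ hy⟩⟩
  have hval' : ∀ {k : M} {s : S} {y : M}, (s • n, y) ∈ G → h ⟨k, s • n⟩ = y := fun hy =>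
    hext ⟨hy, hbdd _ _ hy⟩
  -- One of the copies avoids the range of `G`.
  obtain ⟨k, hk⟩ : ∃ k : M, ∀ s : S, s • n ∉ dom G → h ⟨k, s • n⟩ ∉ ran G := by
    by_contra! hcon
    choose s hs hsG using hcon
    have : #M ≤ #(ran G) :=
      mk_le_of_injective (f := fun k => (⟨_, hsG k⟩ : ran G)) fun k k' hkk =>
        congrArg Sigma.fst
          (hinj (hdom.not.2 (hs k)) (hdom.not.2 (hs k')) (congrArg Subtype.val hkk))
    rw [hc.mk_act] at this
    exact (this.trans (mk_ran_le G)).not_gt hGl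
  have hsm : ∀ s : S, s • h ⟨k, n⟩ = h ⟨k, s • n⟩ := fun s => (map_smul h s _).symm
  refine ⟨h ⟨k, n⟩, fun s t => ?_, fun s x y hxy => ?_⟩
  · rw [hsm, hsm]
    refine ⟨fun hst => by rw [hst], fun hst => ?_⟩
    by_cases hs : s • n ∈ dom G <;> by_cases ht : t • n ∈ dom G
    · obtain ⟨y, hy⟩ := hs
      obtain ⟨z, hz⟩ := ht
      rw [hval' hy, hval' hz] at hst
      subst hst
      exact hG.inj hy hz
    · obtain ⟨y, hy⟩ := hs
      refine absurd ?_ (hA ⟨k, t • n⟩ (hdom.not.2 ht))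
      rw [← hst, hval' hy]
      exact hbdd _ _ hy
    · obtain ⟨y, hy⟩ := ht
      refine absurd ?_ (hA ⟨k, s • n⟩ (hdom.not.2 hs))
      rw [hst, hval' hy]
      exact hbdd _ _ hy
    · exact congrArg (fun p : Σ _ : M, N => p.2) (hinj (hdom.not.2 hs) (hdom.not.2 ht) hst)
  · rw [hsm]
    constructor
    · rintro rfl
      exact hval' hxy
    · intro hy
      by_cases hs : s • n ∈ dom G
      · obtain ⟨z, hz⟩ := hs
        rw [hval' hz] at hy
        subst hy
        exact hG.inj hz hxy
      · exact absurd ⟨x, hy ▸ hxy⟩ (hk s hs)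

end

/-! ### Limit models of small cofinality -/

section
variable {S : Type u} [Monoid S] {M M' : Type u} [MulAction S M] [MulAction S M']

theorem exists_ideal_of_lt_gamma {κ : Cardinal.{u}} (hκ : ℵ₀ ≤ κ) (h : κ < gamma S) :
    ∃ I : SubMulAction S S, ∀ X : Set S, #X < κ → SubMulAction.closure S X ≠ I := by
  by_contra! hcon
  exact (csInf_le' (show κ ∈ {κ : Cardinal.{u} | ℵ₀ ≤ κ ∧ IdealsGeneratedByLT S κ} from
    ⟨hκ, hcon⟩)).not_gt h

namespace IsUniversalChain

variable {lam : Cardinal.{u}} {α α' : Ordinal.{u}} {c : Ordinal.{u} → SubMulAction S M}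
  {c' : Ordinal.{u} → SubMulAction S M'}

/-- A short limit model carries a partial homomorphism from `S` whose range is not contained in
any step of the chain, although its domain has at most `α.cof` generators. -/
theorem exists_unbounded_partialHom (hc : IsUniversalChain lam α c) (hS : #S ≤ lam)
    (hγ : α.cof < gamma S) :
    ∃ (G : SubMulAction S (S × M)) (X : Set S), IsPartialHom G ∧ #X ≤ α.cof ∧
      dom G = SubMulAction.closure S X ∧ ∀ a < α, ∃ s y, (s, y) ∈ G ∧ y ∉ c a := by
  have hreg := isRegular_cof hc.isSuccLimit
  obtain ⟨I, hI⟩ := exists_ideal_of_lt_gamma hreg.1 hγ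
  obtain ⟨β, hβ, hβcof⟩ := exists_cofinal_map α hc.pos.ne'
  -- At stage `i` the domain has at most `card i` generators, so it is smaller than `I`.
  let P : Ordinal.{u} → SubMulAction S (S × M) → Prop := fun i G =>
    IsPartialHom G ∧ (∃ X : Set S, #X ≤ i.card ∧ dom G = SubMulAction.closure S X) ∧ dom G ≤ I ∧
      (i < α.cof.ord → ∃ j < α, ran G ≤ c j)
  let R : Ordinal.{u} → SubMulAction S (S × M) → SubMulAction S (S × M) → Prop :=
    fun i _ G' => ∃ s y, (s, y) ∈ G' ∧ y ∉ c (β i)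
  have h0 : P 0 ⊥ := by
    refine ⟨fun _ _ _ h => h.elim, ⟨∅, by simp, ?_⟩, fun _ ⟨_, h⟩ => h.elim,
      fun _ => ⟨0, hc.pos, fun _ ⟨_, h⟩ => h.elim⟩⟩
    refine le_antisymm (fun _ ⟨_, h⟩ => h.elim) (SubMulAction.closure_le.2 (Set.empty_subset _))
  have hs : ∀ i < α.cof.ord, ∀ G, P i G → ∃ G', G ≤ G' ∧ P (succ i) G' ∧ R i G G' := by
    rintro i hi G ⟨hG, ⟨X, hX, hGX⟩, hGI, hb⟩
    obtain ⟨j, hj, hr⟩ := hb hi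
    obtain ⟨s, hsI, hsG⟩ : ∃ s ∈ I, s ∉ dom G := by
      by_contra! hcon
      exact hI X (hX.trans_lt (Cardinal.lt_ord.1 hi)) (hGX ▸ le_antisymm hGI hcon)
    have hm := max_lt hj (hβ i)
    have hjm := hc.mk_eq _ hm
    obtain ⟨h, hB, hext, -, hA⟩ := (hc.isUniversalOver _ hm).exists_extension
      (by rw [hjm]; exact hc.aleph0_le) (by rw [hjm]; exact hS) hG
      (hr.trans (hc.mono _ _ (le_max_left _ _) hm))
    have hG' : ∀ {x y}, (x, y) ∈ G ⊔ orb (s, h s) → h x = y := by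
      rintro x y (hxy | ⟨t, ht⟩)
      · exact hext hxy
      · obtain ⟨rfl, rfl⟩ := Prod.mk.inj ht
        exact map_smul h t s
    have hdom : dom (G ⊔ orb (s, h s)) = SubMulAction.closure S (insert s X) := by
      refine le_antisymm ?_ (SubMulAction.closure_le.2 ?_)
      · rintro x ⟨y, hxy | ⟨t, ht⟩⟩
        · have : x ∈ dom G := ⟨y, hxy⟩
          rw [hGX] at this
          exact SubMulAction.closure_mono (Set.subset_insert _ _) this
        · obtain ⟨rfl, rfl⟩ := Prod.mk.inj ht
          exact SubMulAction.smul_mem _ t (SubMulAction.subset_closure (Set.mem_insert _ _))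
      · rintro x (rfl | hx)
        · exact ⟨_, Or.inr (self_mem_orb _)⟩
        · have : x ∈ dom G := hGX ▸ SubMulAction.subset_closure hx
          obtain ⟨y, hy⟩ := this
          exact ⟨y, Or.inl hy⟩
    refine ⟨G ⊔ orb (s, h s), le_sup_left, ⟨?_, ⟨insert s X, ?_, hdom⟩, ?_, fun _ =>
      ⟨_, hc.isSuccLimit.succ_lt hm, ?_⟩⟩, s, h s, Or.inr (self_mem_orb _), fun hsβ => ?_⟩
    · intro x y y' hy hy'
      rw [← hG' hy, ← hG' hy']
    · refine (mk_insert_le).trans ?_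
      rw [succ_eq_add_one, Ordinal.card_add_one]
      gcongr
    · rw [hdom]
      refine SubMulAction.closure_le.2 (Set.insert_subset hsI ?_)
      exact fun x hx => hGI (hGX ▸ SubMulAction.subset_closure hx)
    · rintro y ⟨x, hxy⟩
      exact hG' hxy ▸ hB x
    · exact hA s hsG (hc.mono _ _ (le_max_right _ _) hm hsβ)
  have hl : ∀ i ≤ α.cof.ord, IsSuccLimit i → ∀ G : Ordinal.{u} → SubMulAction S (S × M),
      Monotone G → (∀ j < i, P j (G j)) → P i (⨆ j < i, G j) := by
    intro i _ hil G hGm hP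
    refine ⟨IsPartialHom.biSup hGm fun j hj => (hP j hj).1, ?_, ?_, fun hi => ?_⟩
    · choose! X hX hGX using fun j (hj : j < i) => (hP j hj).2.1
      refine ⟨⋃ j < i, X j, ?_, le_antisymm ?_ (SubMulAction.closure_le.2 ?_)⟩
      · refine (mk_biUnion_lt_le fun j hj => (hX j hj).trans (Ordinal.card_le_card hj.le)).trans ?_
        exact (mul_eq_self (Ordinal.aleph0_le_card.2 (Ordinal.omega0_le_of_isSuccLimit hil))).le
      · rintro x ⟨y, hxy⟩
        obtain ⟨j, hj, hxy⟩ := mem_biSup.1 hxy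
        have : x ∈ dom (G j) := ⟨y, hxy⟩
        rw [hGX j hj] at this
        exact SubMulAction.closure_mono (Set.subset_biUnion_of_mem (u := fun j => X j) hj) this
      · intro x hx
        obtain ⟨j, hj, hx⟩ := Set.mem_iUnion₂.1 hx
        obtain ⟨y, hy⟩ : x ∈ dom (G j) := hGX j hj ▸ SubMulAction.subset_closure hx
        exact ⟨y, mem_biSup.2 ⟨j, hj, hy⟩⟩
    · rintro x ⟨y, hxy⟩
      obtain ⟨j, hj, hxy⟩ := mem_biSup.1 hxy
      exact (hP j hj).2.2.1 ⟨y, hxy⟩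
    · choose! f hf hf' using fun j (hj : j < i) => (hP j hj).2.2.2 (hj.trans hi)
      obtain ⟨a, ha, hfa⟩ := exists_bound_Iio_of_lt_cof hi hf
      refine ⟨a, ha, ?_⟩
      rintro y ⟨x, hxy⟩
      obtain ⟨j, hj, hxy⟩ := mem_biSup.1 hxy
      exact hc.mono _ _ (hfa j hj) ha (hf' j hj ⟨x, hxy⟩)
  obtain ⟨G, hGm, -, -, hP, hR⟩ := exists_transfinite_chain α.cof.ord ⊥ P R h0 hs hl
  obtain ⟨hG, ⟨X, hX, hGX⟩, -, -⟩ := hP _ le_rfl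
  refine ⟨G α.cof.ord, X, hG, by simpa using hX, hGX, fun a ha => ?_⟩
  obtain ⟨i, hi, hai⟩ := hβcof a ha
  obtain ⟨s, y, hsy, hy⟩ := hR i hi
  exact ⟨s, y, hGm ((isSuccLimit_ord hreg.1).succ_lt hi).le hsy,
    fun h => hy (hc.mono _ _ hai (hβ i) h)⟩

/-- Partial homomorphisms on ideals with few generators extend. -/
theorem exists_extension_of_lt_cof (hc : IsUniversalChain lam α c) (hS : #S ≤ lam)
    {G : SubMulAction S (S × M)} (hG : IsPartialHom G) {X : Set S} (hX : #X < α.cof)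
    (hGX : dom G = SubMulAction.closure S X) : ∃ b : M, ∀ s y, (s, y) ∈ G → s • b = y := by
  have hval : ∀ x : X, ∃ y, ((x : S), y) ∈ G := fun x =>
    (hGX ▸ SubMulAction.subset_closure x.2 : (x : S) ∈ dom G)
  choose v hv using hval
  choose f hf hvf using fun x => hc.exhausts (v x)
  obtain ⟨i, hi, hfi⟩ := exists_bound_of_lt_cof hX hf
  have hr : ran G ≤ c i := by
    let J : SubMulAction S S :=
      { carrier := {s | ∃ y ∈ c i, (s, y) ∈ G}
        smul_mem' := fun t _ ⟨y, hy, h⟩ => ⟨t • y, (c i).smul_mem t hy, G.smul_mem t h⟩ }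
    have hJ : dom G ≤ J := by
      rw [hGX, SubMulAction.closure_le]
      exact fun x hx => ⟨_, hc.mono _ _ (hfi ⟨x, hx⟩) hi (hvf ⟨x, hx⟩), hv ⟨x, hx⟩⟩
    rintro y ⟨s, hsy⟩
    obtain ⟨y', hy', h⟩ := hJ ⟨y, hsy⟩
    rwa [hG hsy h]
  obtain ⟨h, -, hext, -⟩ := (hc.isUniversalOver _ hi).exists_extension
    (by rw [hc.mk_eq i hi]; exact hc.aleph0_le) (by rw [hc.mk_eq i hi]; exact hS) hG hr
  refine ⟨h 1, fun s y hsy => ?_⟩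
  rw [← map_smul, smul_eq_mul, mul_one, hext hsy]

/-- A limit model whose cofinality is less than `γ(S)` is not isomorphic to limit models of
larger cofinality. -/
theorem not_isIsomorphic (hc : IsUniversalChain lam α c) (hc' : IsUniversalChain lam α' c')
    (hS : #S ≤ lam) (hγ : α.cof < gamma S) (hcof : α.cof < α'.cof) : ¬ IsIsomorphic S M M' := by
  rintro ⟨f, hf⟩
  obtain ⟨G, X, hG, hX, hGX, hu⟩ := hc.exists_unbounded_partialHom hS hγ
  let G' : SubMulAction S (S × M') :=
    { carrier := {p | ∃ y, (p.1, y) ∈ G ∧ f y = p.2}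
      smul_mem' := fun s p ⟨y, hy, hy'⟩ => ⟨s • y, G.smul_mem s hy, by rw [map_smul, hy']; rfl⟩ }
  obtain ⟨b', hb'⟩ := hc'.exists_extension_of_lt_cof hS (G := G')
    (by
      rintro s _ _ ⟨y, hy, rfl⟩ ⟨z, hz, rfl⟩
      exact congrArg f (hG hy hz))
    (hX.trans_lt hcof) (by
      rw [← hGX]
      ext s
      exact ⟨fun ⟨_, y, hy, _⟩ => ⟨y, hy⟩, fun ⟨y, hy⟩ => ⟨f y, y, hy, rfl⟩⟩)
  obtain ⟨b, rfl⟩ := hf.2 b'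
  obtain ⟨a, ha, hba⟩ := hc.exhausts b
  obtain ⟨s, y, hsy, hy⟩ := hu a ha
  have := hb' s (f y) ⟨y, hsy, rfl⟩
  rw [← map_smul] at this
  exact hy (hf.1 this ▸ (c a).smul_mem s hba)

end IsUniversalChain
end

/-! ### Stability and the existence of limit models -/

section
variable {S : Type u} [Monoid S] {M U : Type u} [MulAction S M] [MulAction S U]

/-- The invariants of a type `(b, M, N)`: the pairs `(s, t)` with `s b = t b` and the pairs `(s, m)`
with `s b = m`, for `m ∈ M`. -/
def PreType.invariants (p : PreType S M) : Set (S × S) × Set (S × M) :=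
  ({x | x.1 • p.elt = x.2 • p.elt}, {x | x.1 • p.elt = p.incl x.2})

theorem PreType.AtomicEquiv.invariants_eq {p q : PreType S M} (h : p.AtomicEquiv q) :
    p.invariants = q.invariants := by
  obtain ⟨P, _, f, g, hf, hg, hM, he⟩ := h
  refine Prod.ext (Set.ext fun x => ?_) (Set.ext fun x => ?_)
  · change x.1 • p.elt = x.2 • p.elt ↔ x.1 • q.elt = x.2 • q.elt
    rw [← hf.eq_iff, ← hg.eq_iff, map_smul, map_smul, map_smul, map_smul, he]
  · change x.1 • p.elt = p.incl x.2 ↔ x.1 • q.elt = q.incl x.2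
    rw [← hf.eq_iff, ← hg.eq_iff, map_smul, map_smul, he, hM]

/-- The invariants of a Galois type. -/
def GaloisType.invariants : GaloisType S M → Set (S × S) × Set (S × M) :=
  Quotient.lift PreType.invariants fun p q (h : Relation.TransGen PreType.AtomicEquiv p q) => by
    induction h with
    | single h => exact h.invariants_eq
    | tail _ h ih => exact ih.trans h.invariants_eq

/-- Two elements of an act have the same quantifier free type over a subact. -/
def SameType (A : SubMulAction S U) (b b' : U) : Prop :=
  (∀ s t : S, s • b = t • b ↔ s • b' = t • b') ∧ ∀ s : S, ∀ a ∈ A, s • b = a ↔ s • b' = a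

/-- In a stable cardinality, the types realized in a big act can be realized in a small one. -/
theorem IsStableIn.exists_realizing {lam : Cardinal.{u}} (h : IsStableIn S lam)
    {A : SubMulAction S U} (hA : #A = lam) :
    ∃ B : SubMulAction S U, A ≤ B ∧ #B = lam ∧ ∀ b, ∃ b' ∈ B, SameType A b b' := by
  have hS : #S ≤ lam := (self_le_add_right _ _).trans h.1
  have hω : ℵ₀ ≤ lam := (self_le_add_left _ _).trans h.1
  let p : U → PreType S A := fun b =>
    { carrier := U, incl := A.subtype, incl_injective := Subtype.val_injective, elt := b }
  let τ : U → GaloisType S A := fun b => Quotient.mk (preTypeSetoid S A) (p b)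
  have hτ : ∀ {b b'}, τ b = τ b' → SameType A b b' := by
    intro b b' hbb
    have h := congrArg GaloisType.invariants hbb
    have h1 := fun x => Set.ext_iff.1 (congrArg Prod.fst h) x
    have h2 := fun x => Set.ext_iff.1 (congrArg Prod.snd h) x
    exact ⟨fun s t => h1 (s, t), fun s a ha => h2 (s, ⟨a, ha⟩)⟩
  choose rep hrep using fun q : Set.range τ => q.2
  let Y : Set U := Set.range rep
  have hY : #Y ≤ lam := by
    rw [← Cardinal.lift_le.{u + 1}]
    refine le_trans ?_ (h.2 A hA)
    rw [← Cardinal.lift_id'.{u, u + 1} #(GaloisType S A)]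
    refine Cardinal.lift_mk_le_lift_mk_of_injective (f := fun y : Y => τ y) ?_
    rintro ⟨_, q, rfl⟩ ⟨_, q', rfl⟩ hqq
    simp only [hrep] at hqq
    exact Subtype.ext (congrArg rep (Subtype.ext hqq))
  let O : SubMulAction S U :=
    { carrier := Set.range fun x : S × Y => x.1 • (x.2 : U)
      smul_mem' := by
        rintro t _ ⟨⟨s, y⟩, rfl⟩
        exact ⟨⟨t * s, y⟩, mul_smul _ _ _⟩ }
  have hO : #O ≤ lam := by
    refine (mk_range_le (f := fun x : S × Y => x.1 • (x.2 : U))).trans ?_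
    rw [mk_prod, Cardinal.lift_id, Cardinal.lift_id]
    exact (mul_le_mul' hS hY).trans (mul_eq_self hω).le
  refine ⟨A ⊔ O, le_sup_left, le_antisymm ?_ (hA ▸ mk_mono le_sup_left), fun b => ?_⟩
  · exact mk_sup_le.trans ((add_le_add hA.le hO).trans (add_eq_self hω).le)
  · let q : Set.range τ := ⟨τ b, b, rfl⟩
    refine ⟨rep q, Or.inr ⟨⟨1, rep q, q, rfl⟩, one_smul _ _⟩, hτ (hrep q).symm⟩

theorem mk_biSup_eq {lam : Cardinal.{u}} (hω : ℵ₀ ≤ lam) {i : Ordinal.{u}} (hi : 0 < i)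
    (hil : i.card ≤ lam) {c : Ordinal.{u} → SubMulAction S U} (hc : ∀ j < i, #(c j) = lam) :
    #(⨆ j < i, c j : SubMulAction S U) = lam := by
  refine le_antisymm ?_ ?_
  · refine (mk_biSup_le fun j hj => (hc j hj).le).trans ?_
    exact (mul_le_mul_left hil _).trans (mul_eq_self hω).le
  · rw [← hc 0 hi]
    exact mk_mono (le_iSup₂_of_le 0 hi le_rfl)

/-- In a stable cardinality, universal extensions exist. -/
theorem IsStableIn.exists_isUniversalOver {lam : Cardinal.{u}} (h : IsStableIn S lam)
    {X : Type u} (hX : lam < #X) {A : SubMulAction S (Cofree S X)} (hA : #A = lam) :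
    ∃ B : SubMulAction S (Cofree S X), #B = lam ∧ IsUniversalOver B A := by
  have hω : ℵ₀ ≤ lam := (self_le_add_left _ _).trans h.1
  have hδ : IsSuccLimit lam.ord := isSuccLimit_ord hω
  -- An increasing chain of length `lam`, in which each act realizes all types over the previous.
  obtain ⟨c, hcm, hc0, -, hcP, hcR⟩ := exists_transfinite_chain lam.ord A
    (fun _ G => #G = lam) (fun _ G G' => ∀ b, ∃ b' ∈ G', SameType G b b') hA
    (fun i _ G hG => by
      obtain ⟨B, hGB, hB, hBr⟩ := h.exists_realizing hG
      exact ⟨B, hGB, hB, hBr⟩)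
    (fun i hi hil c _ hc => mk_biSup_eq hω hil.bot_lt (by simpa using Ordinal.card_le_card hi) hc)
  refine ⟨c lam.ord, hcP _ le_rfl, hc0 ▸ hcm zero_le, by rw [hcP _ le_rfl, hA], ?_⟩
  intro N _ j hj hN
  rw [hA] at hN
  obtain ⟨n, hn⟩ := exists_enumeration hN (aleph0_pos.trans_le hω).ne'
  let G₀ : SubMulAction S (N × Cofree S X) :=
    { carrier := {p | ∃ a : A, j a = p.1 ∧ (a : Cofree S X) = p.2}
      smul_mem' := fun s p ⟨a, h, h'⟩ =>
        ⟨s • a, by rw [map_smul, h]; rfl, congrArg (s • ·) h'⟩ }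
  let P : Ordinal.{u} → SubMulAction S (N × Cofree S X) → Prop := fun i G =>
    IsPartialIso G ∧ ran G ≤ c i
  have h0 : P 0 G₀ := by
    refine ⟨⟨?_, ?_⟩, ?_⟩
    · rintro x y y' ⟨a, ha, rfl⟩ ⟨a', ha', rfl⟩
      exact congrArg Subtype.val (hj (ha.trans ha'.symm))
    · rintro x x' y ⟨a, rfl, ha⟩ ⟨a', rfl, ha'⟩
      exact congrArg j (Subtype.ext (ha.trans ha'.symm))
    · rintro y ⟨x, a, -, rfl⟩
      rw [hc0]
      exact a.2
  have hs : ∀ i < lam.ord, ∀ G, P i G → ∃ G', G ≤ G' ∧ P (succ i) G' ∧ n i ∈ dom G' := by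
    rintro i hi G ⟨hG, hr⟩
    have hci := hcP i hi.le
    obtain ⟨g, hext, hinj, hD⟩ := exists_cofree_extension hG.hom (c i) (hω.trans hX.le)
      (hN.trans_lt hX) (hci.trans_lt hX)
    have hg : Function.Injective g := hG.injective_of_extension hr hext hinj hD
    obtain ⟨b', hb', hsame⟩ := hcR i hi (g (n i))
    have hmatch : MatchesOver G (n i) b' := by
      refine ⟨fun s t => ?_, fun s x y hxy => ?_⟩
      · rw [← hsame.1, ← map_smul, ← map_smul, hg.eq_iff]
      · rw [← hsame.2 s y (hr ⟨x, hxy⟩), ← map_smul, ← hext hxy, hg.eq_iff]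
    refine ⟨G ⊔ orb (n i, b'), le_sup_left, ⟨hG.sup_orb hmatch, ?_⟩,
      ⟨b', Or.inr (self_mem_orb _)⟩⟩
    rintro y ⟨x, hxy | ⟨s, hs⟩⟩
    · exact hcm (le_succ i) (hr ⟨x, hxy⟩)
    · obtain ⟨-, rfl⟩ := Prod.mk.inj hs
      exact (c (succ i)).smul_mem s hb'
  have hl : ∀ i ≤ lam.ord, IsSuccLimit i → ∀ G : Ordinal.{u} → SubMulAction S (N × Cofree S X),
      Monotone G → (∀ j < i, P j (G j)) → P i (⨆ j < i, G j) := by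
    intro i _ _ G hGm hP
    refine ⟨IsPartialIso.biSup hGm fun j hj => (hP j hj).1, ?_⟩
    rintro y ⟨x, hxy⟩
    obtain ⟨k, hk, hxy⟩ := mem_biSup.1 hxy
    exact hcm hk.le ((hP k hk).2 ⟨x, hxy⟩)
  obtain ⟨G, hGm, hG0, -, hP, hR⟩ := exists_transfinite_chain lam.ord G₀ P
    (fun i _ G' => n i ∈ dom G') h0 hs hl
  obtain ⟨hG, hr⟩ := hP _ le_rfl
  obtain ⟨f, hf⟩ := hG.hom.exists_hom fun x => by
    obtain ⟨i, hi, rfl⟩ := hn x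
    obtain ⟨y, hy⟩ := hR i hi
    exact ⟨y, hGm (hδ.succ_lt hi).le hy⟩
  refine ⟨⟨fun x => ⟨f x, hr ⟨x, hf x⟩⟩, fun s x => Subtype.ext (map_smul f s x)⟩, ?_, ?_⟩
  · intro x x' hxx
    have hxx' : f x = f x' := congrArg Subtype.val hxx
    exact hG.inj (hf x) (hxx' ▸ hf x')
  · intro a
    have : (j a, (a : Cofree S X)) ∈ G lam.ord :=
      hGm zero_le (hG0 ▸ (⟨a, rfl, rfl⟩ : (j a, (a : Cofree S X)) ∈ G₀))
    exact hG.hom (hf _) this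

/-- The part of the subact `A` inside the subact `V`, as a subact of `V`. -/
def restrict (V A : SubMulAction S U) : SubMulAction S V where
  carrier := {x | (x : U) ∈ A}
  smul_mem' s _ h := A.smul_mem s h

theorem mk_restrict {V A : SubMulAction S U} (h : A ≤ V) : #(restrict V A) = #A :=
  mk_congr ⟨fun x => ⟨x.1.1, x.2⟩, fun x => ⟨⟨x.1, h x.2⟩, x.2⟩, fun _ => rfl, fun _ => rfl⟩

theorem IsUniversalOver.restrict {V A B : SubMulAction S U} (h : IsUniversalOver B A)
    (hB : B ≤ V) : IsUniversalOver (restrict V B) (restrict V A) := by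
  have hA := h.1.trans hB
  refine ⟨fun x hx => h.1 hx, by rw [mk_restrict hB, mk_restrict hA, h.2.1], ?_⟩
  intro N _ j hj hN
  rw [mk_restrict hA] at hN
  obtain ⟨f, hf, hfj⟩ := h.2.2 N
    ⟨fun a : A => j ⟨⟨a, hA a.2⟩, a.2⟩, fun s a => map_smul j s ⟨⟨a, hA a.2⟩, a.2⟩⟩
    (fun a a' haa => Subtype.ext (congrArg (fun x => (x.1 : U)) (hj haa))) hN
  refine ⟨⟨fun x => ⟨⟨f x, hB (f x).2⟩, (f x).2⟩, fun s x => ?_⟩, ?_, fun a => ?_⟩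
  · exact Subtype.ext (Subtype.ext (congrArg (fun y : B => (y : U)) (map_smul f s x)))
  · intro x x' hxx
    exact hf (Subtype.ext (congrArg (fun x => (x.1 : U)) hxx))
  · exact Subtype.ext (hfj ⟨a.1, a.2⟩)

/-- In a stable cardinality, there are limit models of all lengths. -/
theorem IsStableIn.exists_isLimitModelOver {lam : Cardinal.{u}} (h : IsStableIn S lam)
    {α : Ordinal.{u}} (hα : IsSuccLimit α) (hαl : α < (succ lam).ord) :
    ∃ (M : Type u) (_ : MulAction S M) (N : SubMulAction S M), IsLimitModelOver lam α M N := by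
  have hω : ℵ₀ ≤ lam := (self_le_add_left _ _).trans h.1
  let X : Type u := (succ lam).ord.ToType
  have hX : lam < #X := by rw [mk_ord_toType]; exact lt_succ _
  -- A subact of cardinality `lam` consists of constant functions.
  obtain ⟨T, hT⟩ := Cardinal.le_mk_iff_exists_set.1 hX.le
  let A : SubMulAction S (Cofree S X) :=
    { carrier := Set.range fun (x : T) (_ : S) => (x : X)
      smul_mem' := by
        rintro s _ ⟨x, rfl⟩
        exact ⟨x, rfl⟩ }
  have hA : #A = lam := by
    rw [← hT]
    exact mk_range_eq (fun (x : T) (_ : S) => (x : X)) fun x y hxy =>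
      Subtype.ext (congrFun hxy 1)
  have hcard : ∀ i ≤ α, i.card ≤ lam := fun i hi =>
    lt_succ_iff.1 (Cardinal.lt_ord.1 (hi.trans_lt hαl))
  obtain ⟨c, hcm, -, hcl, hcP, hcR⟩ := exists_transfinite_chain α A (fun _ G => #G = lam)
    (fun _ G G' => IsUniversalOver G' G) hA
    (fun i _ G hG => by
      obtain ⟨B, hB, hBG⟩ := h.exists_isUniversalOver hX hG
      exact ⟨B, hBG.1, hB, hBG⟩)
    (fun i hi hil c _ hc => mk_biSup_eq hω hil.bot_lt (hcard i hi) hc)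
  refine ⟨c α, inferInstance, restrict (c α) (c 0), hω, hα, hαl, fun i => restrict (c α) (c i),
    fun i hi => ?_, fun i j hij _ x hx => hcm hij hx, fun i _ hil => ?_, rfl, ?_, fun i hi => ?_⟩
  · rw [mk_restrict (hcm hi.le), hcP i hi.le]
  · ext x
    have : (x : Cofree S X) ∈ c i ↔ ∃ j < i, (x : Cofree S X) ∈ c j := by
      rw [hcl i hil, mem_biSup]
    simp only [Set.mem_iUnion, exists_prop]
    exact this
  · refine Set.eq_univ_of_forall fun x => ?_
    have hx : (x : Cofree S X) ∈ ⨆ j < α, c j := hcl α hα ▸ x.2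
    obtain ⟨j, hj, hx⟩ := mem_biSup.1 hx
    exact Set.mem_iUnion₂.2 ⟨j, hj, hx⟩
  · exact (hcR i hi).restrict (hcm (hα.succ_lt hi).le)

end

/-! ### A cardinal in which the class of acts is stable -/

section
variable {S : Type u} [Monoid S] {M : Type u} [MulAction S M]

/-- A Galois type is determined by its invariants. -/
theorem PreType.atomicEquiv_of_invariants_eq {p q : PreType S M}
    (h : p.invariants = q.invariants) : p.AtomicEquiv q := by
  have h1 : ∀ s t : S, s • p.elt = t • p.elt ↔ s • q.elt = t • q.elt := fun s t =>
    Set.ext_iff.1 (congrArg Prod.fst h) (s, t)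
  have h2 : ∀ (s : S) m, s • p.elt = p.incl m ↔ s • q.elt = q.incl m := fun s m =>
    Set.ext_iff.1 (congrArg Prod.snd h) (s, m)
  let κ : Cardinal.{u} := #p.carrier + #q.carrier + ℵ₀
  let X : Type u := (succ κ).ord.ToType
  have hκX : κ < #X := by rw [mk_ord_toType]; exact lt_succ _
  have hX : ℵ₀ ≤ #X := (self_le_add_left _ _).trans hκX.le
  have hp : #p.carrier < #X :=
    ((self_le_add_right _ _).trans (self_le_add_right _ _)).trans_lt hκX
  have hq : #q.carrier < #X :=
    ((self_le_add_left _ _).trans (self_le_add_right _ _)).trans_lt hκX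
  obtain ⟨f, hf⟩ := exists_cofree_embedding (S := S) hX hp
  let G₀ : SubMulAction S (q.carrier × Cofree S X) :=
    { carrier := {x | ∃ m, q.incl m = x.1 ∧ f (p.incl m) = x.2}
      smul_mem' := fun s x ⟨m, h, h'⟩ =>
        ⟨s • m, by rw [map_smul, h]; rfl, by rw [map_smul, map_smul, h']; rfl⟩ }
  have hG₀ : IsPartialIso G₀ := by
    constructor
    · rintro x y y' ⟨m, hm, rfl⟩ ⟨m', hm', rfl⟩
      rw [q.incl_injective (hm.trans hm'.symm)]
    · rintro x x' y ⟨m, rfl, hm⟩ ⟨m', rfl, hm'⟩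
      rw [p.incl_injective (hf (hm.trans hm'.symm))]
  have hmatch : MatchesOver G₀ q.elt (f p.elt) := by
    refine ⟨fun s t => ?_, ?_⟩
    · rw [← h1, ← map_smul, ← map_smul, hf.eq_iff]
    · rintro s x y ⟨m, rfl, rfl⟩
      rw [← h2, ← map_smul, hf.eq_iff]
  have hG := hG₀.sup_orb hmatch
  have hr : (ran (G₀ ⊔ orb (q.elt, f p.elt)) : Set (Cofree S X)) ⊆ Set.range f := by
    rintro y ⟨x, ⟨m, -, rfl⟩ | ⟨s, hs⟩⟩
    · exact ⟨_, rfl⟩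
    · obtain ⟨-, rfl⟩ := Prod.mk.inj hs
      exact ⟨s • p.elt, map_smul f s _⟩
  obtain ⟨g, hext, hinj, hD⟩ := exists_cofree_extension hG.hom (Set.range f) hX hq
    (mk_range_le.trans_lt hp)
  exact ⟨Cofree S X, inferInstance, f, g, hf, hG.injective_of_extension hr hext hinj hD,
    fun m => (hext (Or.inl ⟨m, rfl, rfl⟩)).symm, (hext (Or.inr (self_mem_orb _))).symm⟩

theorem GaloisType.invariants_injective :
    Function.Injective (GaloisType.invariants (S := S) (M := M)) := by
  rintro ⟨p⟩ ⟨q⟩ h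
  exact Quotient.sound (Relation.TransGen.single (PreType.atomicEquiv_of_invariants_eq h))

open Classical in
/-- The second invariant of a Galois type is a partial function from `S` to `M`. -/
noncomputable def GaloisType.value (q : GaloisType S M) (s : S) : Option M :=
  if h : ∃ m, (s, m) ∈ q.invariants.2 then some h.choose else none

theorem GaloisType.value_eq_some {q : GaloisType S M} {s : S} {m : M} :
    q.value s = some m ↔ (s, m) ∈ q.invariants.2 := by
  have huniq : ∀ {m m'}, (s, m) ∈ q.invariants.2 → (s, m') ∈ q.invariants.2 → m = m' := by
    obtain ⟨p⟩ := q
    intro m m' (h : s • p.elt = p.incl m) (h' : s • p.elt = p.incl m')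
    exact p.incl_injective (h.symm.trans h')
  unfold GaloisType.value
  split_ifs with h
  · rw [Option.some_inj]
    exact ⟨fun hm => hm ▸ h.choose_spec, huniq h.choose_spec⟩
  · exact ⟨fun hm => hm.elim, fun hm => absurd ⟨m, hm⟩ h⟩

theorem isStableIn_two_power (S : Type u) [Monoid S] : IsStableIn S (2 ^ (#S + ℵ₀)) := by
  set μ : Cardinal.{u} := #S + ℵ₀ with hμ
  have hω : ℵ₀ ≤ μ := self_le_add_left _ _
  have hS : #S ≤ μ := self_le_add_right _ _
  refine ⟨(cantor μ).le, fun M _ hM => ?_⟩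
  have hlam : ℵ₀ ≤ (2 : Cardinal.{u}) ^ μ := hω.trans (cantor μ).le
  have hinj : Function.Injective fun q : GaloisType S M => (q.invariants.1, q.value) := by
    intro q q' h
    obtain ⟨h, h'⟩ := Prod.mk.inj h
    apply GaloisType.invariants_injective
    refine Prod.ext h (Set.ext fun ⟨s, m⟩ => ?_)
    rw [← GaloisType.value_eq_some, ← GaloisType.value_eq_some,
      congrFun h' s]
  have h1 : #(Set (S × S) × (S → Option M)) ≤ 2 ^ μ := by
    have hsq : #(Set (S × S)) ≤ 2 ^ μ := by
      rw [mk_set, mk_prod, Cardinal.lift_id]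
      refine power_le_power_left two_ne_zero ?_
      exact (mul_le_mul' hS hS).trans (mul_eq_self hω).le
    have hfun : #(S → Option M) ≤ 2 ^ μ := by
      rw [← power_def, mk_option, hM, add_one_eq hlam]
      calc ((2 : Cardinal.{u}) ^ μ) ^ #S ≤ (2 ^ μ) ^ μ :=
            power_le_power_left (aleph0_pos.trans_le hlam).ne' hS
        _ = 2 ^ μ := by rw [← power_mul, mul_eq_self hω]
    rw [mk_prod, Cardinal.lift_id, Cardinal.lift_id]
    exact (mul_le_mul' hsq hfun).trans (mul_eq_self hlam).le
  have h2 := Cardinal.lift_mk_le_lift_mk_of_injective hinj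
  rw [Cardinal.lift_id'.{u, u + 1}] at h2
  exact h2.trans (Cardinal.lift_le.2 h1)

end

/-! ### The number of limit models -/

section
variable {S : Type u} [Monoid S]

theorem IsIsomorphic.symm {A B : Type u} [MulAction S A] [MulAction S B]
    (h : IsIsomorphic S A B) : IsIsomorphic S B A := by
  obtain ⟨f, hf⟩ := h
  obtain ⟨g, hgf, hfg⟩ := Function.bijective_iff_has_inverse.1 hf
  exact ⟨f.inverse g hgf hfg, Function.bijective_iff_has_inverse.2 ⟨f, hfg, hgf⟩⟩

theorem IsIsomorphic.trans {A B C : Type u} [MulAction S A] [MulAction S B] [MulAction S C]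
    (h : IsIsomorphic S A B) (h' : IsIsomorphic S B C) : IsIsomorphic S A C := by
  obtain ⟨f, hf⟩ := h
  obtain ⟨g, hg⟩ := h'
  exact ⟨g.comp f, hg.comp hf⟩

theorem HasExactlyLimitModels.card_le {lam : Cardinal.{u}} {k l : ℕ}
    (h : HasExactlyLimitModels S lam k) (L : Fin l → Type u) [∀ i, MulAction S (L i)]
    (hL : ∀ i, IsLimitModel S lam (L i)) (hne : ∀ i j, i ≠ j → ¬ IsIsomorphic S (L i) (L j)) :
    l ≤ k := by
  obtain ⟨L', _, -, -, hex⟩ := h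
  choose f hf using fun i => hex (L i) (hL i)
  have hinj : Function.Injective f := by
    intro i j hij
    by_contra hne'
    exact hne i j hne' ((hf i).trans (hij ▸ (hf j).symm))
  simpa using Fintype.card_le_of_injective f hinj

theorem HasExactlyLimitModels.unique {lam : Cardinal.{u}} {k l : ℕ}
    (h : HasExactlyLimitModels S lam k) (h' : HasExactlyLimitModels S lam l) : k = l := by
  have aux : ∀ {k l : ℕ}, HasExactlyLimitModels S lam k →
      HasExactlyLimitModels S lam l → l ≤ k := by
    rintro k l h ⟨L, _, hL, hne, -⟩
    exact h.card_le L hL hne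
  exact le_antisymm (aux h' h) (aux h h')

theorem gamma_le_succ (S : Type u) [Monoid S] : gamma S ≤ succ (#S + ℵ₀) := by
  refine csInf_le' ⟨(self_le_add_left _ _).trans (le_succ _), fun I => ⟨I, ?_,
    le_antisymm (SubMulAction.closure_le.2 le_rfl) SubMulAction.subset_closure⟩⟩
  exact ((mk_set_le _).trans (self_le_add_right _ _)).trans_lt (lt_succ _)

theorem gamma_le_two_power (S : Type u) [Monoid S] : gamma S ≤ 2 ^ (#S + ℵ₀) :=
  (gamma_le_succ S).trans (succ_le_of_lt (cantor _))

theorem isRegular_aleph_natCast (m : ℕ) : (ℵ_ (m : Ordinal.{u})).IsRegular := by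
  cases m with
  | zero => rw [Nat.cast_zero, aleph_zero]; exact isRegular_aleph0
  | succ m => rw [Nat.cast_succ]; exact isRegular_aleph_add_one _

/-- If `ℵ_m ≤ γ(S)`, then the limit models of lengths `ℵ_0, …, ℵ_m` are pairwise not isomorphic. -/
theorem IsStableIn.exists_family {lam : Cardinal.{u}} (h : IsStableIn S lam) {m : ℕ}
    (hm : ℵ_ (m : Ordinal.{u}) ≤ gamma S) (hml : ℵ_ (m : Ordinal.{u}) ≤ lam) :
    ∃ (L : Fin (m + 1) → Type u) (_ : ∀ i, MulAction S (L i)),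
      (∀ i, ∃ N : SubMulAction S (L i),
        IsLimitModelOver lam (ℵ_ ((i : ℕ) : Ordinal.{u})).ord (L i) N) ∧
      ∀ i j, i ≠ j → ¬ IsIsomorphic S (L i) (L j) := by
  have hS : #S ≤ lam := (self_le_add_right _ _).trans h.1
  have hle : ∀ i : Fin (m + 1), ℵ_ ((i : ℕ) : Ordinal.{u}) ≤ ℵ_ (m : Ordinal.{u}) := fun i =>
    aleph_le_aleph.2 (Nat.cast_le.2 (Nat.lt_succ_iff.1 i.2))
  have hex := fun i : Fin (m + 1) => h.exists_isLimitModelOver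
    (isSuccLimit_ord (aleph0_le_aleph ((i : ℕ) : Ordinal.{u})))
    (ord_lt_ord.2 (lt_succ_iff.2 ((hle i).trans hml)))
  choose L hL N hN using hex
  refine ⟨L, hL, fun i => ⟨N i, hN i⟩, ?_⟩
  have hlt : ∀ i j, i < j → ¬ IsIsomorphic S (L i) (L j) := by
    intro i j hij
    obtain ⟨c, hc⟩ := (hN i).exists_isUniversalChain
    obtain ⟨c', hc'⟩ := (hN j).exists_isUniversalChain
    have hij' : ℵ_ ((i : ℕ) : Ordinal.{u}) < ℵ_ ((j : ℕ) : Ordinal.{u}) :=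
      aleph_lt_aleph.2 (Nat.cast_lt.2 hij)
    refine hc.not_isIsomorphic hc' hS ?_ ?_
    · rw [(isRegular_aleph_natCast i).cof_ord]
      exact hij'.trans_le ((hle j).trans hm)
    · rwa [(isRegular_aleph_natCast i).cof_ord, (isRegular_aleph_natCast j).cof_ord]
  intro i j hij
  rcases lt_or_gt_of_ne hij with hij | hij
  · exact hlt i j hij
  · exact fun hiso => hlt j i hij hiso.symm

theorem exists_nat_of_lt_aleph {κ : Cardinal.{u}} (hκ : ℵ₀ ≤ κ) {m : ℕ}
    (h : κ < ℵ_ (m : Ordinal.{u})) : ∃ k < m, κ = ℵ_ (k : Ordinal.{u}) := by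
  obtain ⟨o, rfl⟩ := mem_range_aleph_iff.2 hκ
  have ho := aleph_lt_aleph.1 h
  obtain ⟨k, rfl⟩ := Ordinal.lt_omega0.1 (ho.trans (Ordinal.natCast_lt_omega0 m))
  exact ⟨k, Nat.cast_lt.1 ho, rfl⟩

/-- If `γ(S) = ℵ_m`, then the limit models of lengths `ℵ_0, …, ℵ_m` represent all limit models. -/
theorem hasExactlyLimitModels_of_gamma_eq {lam : Cardinal.{u}} (h : IsStableIn S lam)
    (hlam : 2 ^ (#S + ℵ₀) ≤ lam) {m : ℕ} (hm : gamma S = ℵ_ (m : Ordinal.{u})) :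
    HasExactlyLimitModels S lam (m + 1) := by
  have hml : ℵ_ (m : Ordinal.{u}) ≤ lam := hm ▸ (gamma_le_two_power S).trans hlam
  obtain ⟨L, _, hL, hne⟩ := h.exists_family hm.ge hml
  refine ⟨L, _, fun i => ⟨_, hL i⟩, hne, ?_⟩
  rintro M _ ⟨α, N, hM⟩
  obtain ⟨c, hc⟩ := hM.exists_isUniversalChain
  rcases lt_or_ge α.cof (ℵ_ (m : Ordinal.{u})) with hcof | hcof
  · obtain ⟨k, hk, hkα⟩ := exists_nat_of_lt_aleph (isRegular_cof hc.isSuccLimit).1 hcof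
    let i : Fin (m + 1) := ⟨k, hk.trans m.lt_succ_self⟩
    obtain ⟨N', hN'⟩ := hL i
    obtain ⟨c', hc'⟩ := hN'.exists_isUniversalChain
    refine ⟨i, hc.isIsomorphic_of_cof_eq hc' ?_⟩
    rw [(isRegular_aleph_natCast i).cof_ord, hkα]
  · obtain ⟨N', hN'⟩ := hL (Fin.last m)
    obtain ⟨c', hc'⟩ := hN'.exists_isUniversalChain
    refine ⟨Fin.last m, (hc.isFull (hm.trans_le hcof)).isIsomorphic ((cantor _).trans_le hlam)
      (hc'.isFull ?_) hc.mk_act hc'.mk_act⟩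
    rw [(isRegular_aleph_natCast _).cof_ord, hm, Fin.val_last]

theorem gamma_eq_of_gammaR_eq {n : ℕ} (h : gammaR S = ℵ_ (n : Ordinal.{u})) :
    gamma S = ℵ_ (n : Ordinal.{u}) := by
  unfold gammaR at h
  split_ifs at h with hreg
  · exact h
  · obtain ⟨k, -, hk⟩ := exists_nat_of_lt_aleph (gamma_spec S).1 (h ▸ lt_succ (gamma S))
    exact absurd (hk ▸ isRegular_aleph_natCast k) hreg

theorem gammaR_eq_of_gamma_eq {n : ℕ} (h : gamma S = ℵ_ (n : Ordinal.{u})) :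
    gammaR S = ℵ_ (n : Ordinal.{u}) := by
  unfold gammaR
  rw [if_pos (h ▸ isRegular_aleph_natCast n), h]

end

end SActs

theorem theorem4 (S : Type u) [Monoid S] (n : ℕ) (hn : 1 ≤ n) :
    SActs.gammaR S = ℵ_ (n : Ordinal.{u}) ↔
      ∀ lam : Cardinal.{u}, 2 ^ (#S + ℵ₀) ≤ lam → SActs.IsStableIn S lam →
        SActs.HasExactlyLimitModels S lam (n + 1) := by
  constructor
  · intro h lam hlam hst
    exact SActs.hasExactlyLimitModels_of_gamma_eq hst hlam (SActs.gamma_eq_of_gammaR_eq h)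
  · intro h
    have hst := SActs.isStableIn_two_power S
    have hcount := h _ le_rfl hst
    rcases le_or_gt (ℵ_ ((n + 1 : ℕ) : Ordinal.{u})) (SActs.gamma S) with hγ | hγ
    · obtain ⟨L, _, hL, hne⟩ := hst.exists_family hγ (hγ.trans (SActs.gamma_le_two_power S))
      have := hcount.card_le L (fun i => ⟨_, hL i⟩) hne
      omega
    · obtain ⟨k, -, hk⟩ := SActs.exists_nat_of_lt_aleph (SActs.gamma_spec S).1 hγ
      have := hcount.unique (SActs.hasExactlyLimitModels_of_gamma_eq hst le_rfl hk)
      obtain rfl : n = k := by omega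
      exact SActs.gammaR_eq_of_gamma_eq hk
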